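/- All graphs are finite and simple. A total dominating set of a graph $G$ is a set $S\subseteq V(G)$ such that every vertex of $G$ is adjacent to a vertex of $S$; the total domination number $\gamma_t(G)$ is the minimum cardinality of such a set. A graph $G$ is $k$-$\gamma_t$-vertex-critical if $\gamma_t(G)=k$ and $\gamma_t(G-v)<\gamma_t(G)$ for every vertex $v$ that is not adjacent to a vertex of degree one. A pointed graph is a graph with two assigned vertices, Left and Right, whose distance equals the diameter. For pointed graphs $G_1,G_2$, the pointed graph $G_1\bullet G_2$ is obtained from their disjoint union by identifying the vertex Right of $G_1$ with the vertex Left of $G_2$; its Left is the Left of $G_1$ and its Right is the Right of $G_2$. Let $m\ge 2$ and $t\ge 2$ be integers, and let $H$ be a graph with at least four vertices such that $\gamma_t(H)=\gamma_t(\overline H)=2$. The pointed graph $R$ (depending on $m$) is defined as follows. Let $K_{m,m}$ be the complete bipartite graph with sides $\{y_1,y_3,\dots,y_{2m-1}\}$ and $\{y_2,y_4,\dots,y_{2m}\}$, let $F$ be $K_{m,m}$ without the edge $y_1y_{2m}$, and let $\overline F$ be the complement of $F$, with vertices $x_1,\dots,x_{2m}$, where $x_i$ corresponds to $y_i$. Then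 $R$ is obtained from the disjoint union of $\overline F$ and $K_{m,m}$ by joining $x_i$ to $y_j$ for all $i\ne j$ and adding five new vertices $z_1,z_2,z_3$, Left and Right, where Left is adjacent to all $x_i$; $z_1$ to $x_1,\dots,x_{2m-1},y_2,\dots,y_{2m-1}$; $z_2$ to $x_2,\dots,x_{2m},y_2,\dots,y_{2m-1}$; $z_3$ to all $y_i$ and to $z_1$; and Right to all $y_i$ and to $z_2$. The pointed graph $A$ (depending on $H$) is obtained from the disjoint union of $H$ and $\overline H$ by joining every vertex of $H$ to every vertex of $\overline H$ except the corresponding one, and adding a vertex Left adjacent to all of $H$ and a vertex Right adjacent to all of $\overline H$. The pointed graph $Q$ is obtained from two copies $A_1,A_2$ of $A$ by deleting Right from $A_1$ and Left from $A_2$ and joining every neighbour of the deleted vertex of $A_1$ to every neighbour of the deleted vertex of $A_2$; its Left is that of $A_1$ and its Right is that of $A_2$. Put $Q^{(1)}=Q$ and $Q^{(n)}=Q^{(n-1)}\bullet Q$ for $n\ge 2$; $Q^{(0)}$ is a single vertex, so that $R\bullet Q^{(0)}\bullet J=R\bullet J$. The pointed graph $J$ (depending on $t$) is obtained from the disjoint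 union of $J_1=tK_2$, $J_2=\overline{tK_2}$ and $J_3=tK_2$ (on corresponding vertices) by joining every vertex of $J_2$ to every vertex of $J_1$ and of $J_3$ except the corresponding ones, and adding a vertex Left adjacent to all of $J_1$ and a vertex Right adjacent to all of $J_3$. Theorem. For every integer $n\ge 0$, the graph $G=R\bullet Q^{(n)}\bullet J$ is a $(3n+6)$-$\gamma_t$-vertex-critical graph of diameter $5n+7$, and its vertices Left and Right are at distance $5n+7$. Moreover, for every vertex $v$ of $G$, the graph $G-v$ has a total dominating set of size $3n+5$. -/

import Mathlib

/-! ### Total domination -/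

section TotalDomination

variable {V : Type*}

/-- `S` is a total dominating set of `G`: every vertex of `G` is adjacent to a vertex of `S`. -/
def IsTotalDominatingSet (G : SimpleGraph V) (S : Finset V) : Prop :=
  ∀ v, ∃ s ∈ S, G.Adj v s

/-- The total domination number `γ_t(G)`: the least cardinality of a total dominating set of `G`
(and `⊤` if there is none). -/
noncomputable def totalDominationNumber (G : SimpleGraph V) : ℕ∞ :=
  ⨅ (S : Finset V) (_ : IsTotalDominatingSet G S), (S.card : ℕ∞)

/-- The graph `G - v`. -/
abbrev deleteVertex (G : SimpleGraph V) (v : V) : SimpleGraph ↥({v}ᶜ : Set V) :=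
  G.induce ({v}ᶜ : Set V)

/-- A vertex of degree one. -/
def IsLeafVertex (G : SimpleGraph V) (v : V) : Prop :=
  (G.neighborSet v).encard = 1

/-- `G` is `k`-`γ_t`-vertex-critical: `γ_t(G) = k`, and the removal of any vertex that is not
adjacent to a vertex of degree one decreases the total domination number. -/
def IsTotalDominationVertexCritical (G : SimpleGraph V) (k : ℕ) : Prop :=
  totalDominationNumber G = k ∧
    ∀ v, (∀ u, G.Adj v u → ¬ IsLeafVertex G u) →
      totalDominationNumber (deleteVertex G v) < totalDominationNumber G

end TotalDomination

/-! ### Pointed graphs -/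

universe u v

/-- A graph with two assigned vertices `left` and `right`. That they are diametrical is the
predicate `PointedGraph.IsDiametrical`. -/
structure PointedGraph where
  /-- the vertices -/
  V : Type u
  /-- the graph -/
  graph : SimpleGraph V
  /-- the vertex Left -/
  left : V
  /-- the vertex Right -/
  right : V

namespace PointedGraph

/-- Left and Right are at a distance equal to the (finite) diameter. -/
def IsDiametrical (G : PointedGraph.{u}) : Prop :=
  G.graph.Connected ∧ G.graph.dist G.left G.right = G.graph.diam

/-- The vertices of `G₁ • G₂`: those of `G₁` together with those of `G₂` other than Left. The
vertex Right of `G₁` also plays the role of the vertex Left of `G₂`. -/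
abbrev GlueVert (G₁ : PointedGraph.{u}) (G₂ : PointedGraph.{v}) : Type (max u v) :=
  G₁.V ⊕ {w : G₂.V // w ≠ G₂.left}

/-- The adjacency relation of `G₁ • G₂`. -/
def glueAdj (G₁ : PointedGraph.{u}) (G₂ : PointedGraph.{v}) :
    GlueVert G₁ G₂ → GlueVert G₁ G₂ → Prop
  | .inl a, .inl b => G₁.graph.Adj a b
  | .inl a, .inr b => a = G₁.right ∧ G₂.graph.Adj G₂.left b
  | .inr a, .inl b => b = G₁.right ∧ G₂.graph.Adj G₂.left a
  | .inr a, .inr b => G₂.graph.Adj a b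

open Classical in
/-- The pointed graph `G₁ • G₂`, obtained by identifying the vertex Right of `G₁` with the vertex
Left of `G₂`; its Left is that of `G₁` and its Right is that of `G₂`. -/
noncomputable def glue (G₁ : PointedGraph.{u}) (G₂ : PointedGraph.{v}) :
    PointedGraph.{max u v} where
  V := GlueVert G₁ G₂
  graph :=
    { Adj := glueAdj G₁ G₂
      symm := ⟨by
        rintro (a | a) (b | b) h
        · exact G₁.graph.adj_symm h
        · exact h
        · exact h
        · exact G₂.graph.adj_symm h⟩
      loopless := ⟨by
        rintro (a | a) h
        · exact G₁.graph.loopless.irrefl _ h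
        · exact G₂.graph.loopless.irrefl _ h⟩ }
  left := .inl G₁.left
  right := if h : G₂.right = G₂.left then .inl G₁.right else .inr ⟨G₂.right, h⟩

/-- The pointed graph with a single vertex. -/
def point : PointedGraph.{u} where
  V := PUnit
  graph := ⊥
  left := PUnit.unit
  right := PUnit.unit

/-- `G^(1) = G` and `G^(n) = G^(n-1) • G`. Moreover `G^(0)` is the single vertex, the neutral
element of `•`. -/
noncomputable def pow (G : PointedGraph.{u}) : ℕ → PointedGraph.{u}
  | 0 => point
  | 1 => G
  | n + 2 => glue (pow G (n + 1)) G

end PointedGraph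

/-! ### The pointed graph `R`

The indices `1, …, 2m` are shifted to `0, …, 2m - 1`. -/

/-- The complete bipartite graph `K_{m,m}` on `0, …, 2m - 1`, whose two sides are the even and
the odd numbers. -/
def graphK (m : ℕ) : SimpleGraph (Fin (2 * m)) where
  Adj i j := i.val % 2 ≠ j.val % 2
  symm := ⟨fun _ _ h => h.symm⟩
  loopless := ⟨fun _ h => h rfl⟩

/-- `K_{m,m}` without the edge between the first vertex `0` and the last vertex `2m - 1`. -/
def graphF (m : ℕ) : SimpleGraph (Fin (2 * m)) where
  Adj i j := (graphK m).Adj i j ∧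
    ¬ (i.val = 0 ∧ j.val + 1 = 2 * m) ∧ ¬ (j.val = 0 ∧ i.val + 1 = 2 * m)
  symm := ⟨fun _ _ h => ⟨(graphK m).adj_symm h.1, h.2.2, h.2.1⟩⟩
  loopless := ⟨fun _ h => (graphK m).loopless.irrefl _ h.1⟩

/-- The vertices of `R`. -/
inductive RVert (m : ℕ) : Type
  | x (i : Fin (2 * m))
  | y (i : Fin (2 * m))
  | z1
  | z2
  | z3
  | left
  | right

/-- The edges of `R`, each given in at least one direction. -/
def RRel (m : ℕ) : RVert m → RVert m → Prop
  | .x i, .x j => (graphF m)ᶜ.Adj i j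
  | .y i, .y j => (graphK m).Adj i j
  | .x i, .y j => i ≠ j
  | .left, .x _ => True
  | .z1, .x i => i.val + 1 ≠ 2 * m
  | .z1, .y i => i.val ≠ 0 ∧ i.val + 1 ≠ 2 * m
  | .z2, .x i => i.val ≠ 0
  | .z2, .y i => i.val ≠ 0 ∧ i.val + 1 ≠ 2 * m
  | .z3, .y _ => True
  | .z3, .z1 => True
  | .right, .y _ => True
  | .right, .z2 => True
  | _, _ => False

/-- The pointed graph `R`. -/
def graphR (m : ℕ) : PointedGraph.{0} where
  V := RVert m
  graph := SimpleGraph.fromRel (RRel m)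
  left := .left
  right := .right

/-! ### The pointed graph `Q` -/

/-- The vertices of `Q`: Left and the copies of `H` and `Hᶜ` from `A₁`, then the copies of `H`
and `Hᶜ` and Right from `A₂`. -/
inductive QVert (W : Type u) : Type u
  | left
  | x1 (w : W)
  | y1 (w : W)
  | x2 (w : W)
  | y2 (w : W)
  | right

/-- The edges of `Q`, each given in at least one direction. -/
def QRel {W : Type u} (H : SimpleGraph W) : QVert W → QVert W → Prop
  -- the edges of `A₁` without its vertex Right
  | .left, .x1 _ => True
  | .x1 a, .x1 b => H.Adj a b
  | .x1 a, .y1 b => a ≠ b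
  | .y1 a, .y1 b => Hᶜ.Adj a b
  -- every neighbour of Right in `A₁` is joined to every neighbour of Left in `A₂`
  | .y1 _, .x2 _ => True
  -- the edges of `A₂` without its vertex Left
  | .x2 a, .x2 b => H.Adj a b
  | .x2 a, .y2 b => a ≠ b
  | .y2 a, .y2 b => Hᶜ.Adj a b
  | .y2 _, .right => True
  | _, _ => False

/-- The pointed graph `Q` (built from the graph `H`). -/
def graphQ {W : Type u} (H : SimpleGraph W) : PointedGraph.{u} where
  V := QVert W
  graph := SimpleGraph.fromRel (QRel H)
  left := .left
  right := .right

/-! ### The pointed graph `J` -/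

/-- The disjoint union `tK₂` of `t` edges. -/
def graphTK2 (t : ℕ) : SimpleGraph (Fin t × Bool) where
  Adj p q := p.1 = q.1 ∧ p.2 ≠ q.2
  symm := ⟨fun _ _ h => ⟨h.1.symm, h.2.symm⟩⟩
  loopless := ⟨fun _ h => h.2 rfl⟩

/-- The vertices of `J`: Left, those of `J₁`, `J₂`, `J₃`, and Right. -/
inductive JVert (t : ℕ) : Type
  | left
  | j1 (p : Fin t × Bool)
  | j2 (p : Fin t × Bool)
  | j3 (p : Fin t × Bool)
  | right

/-- The edges of `J`, each given in at least one direction. -/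
def JRel (t : ℕ) : JVert t → JVert t → Prop
  | .left, .j1 _ => True
  | .j1 p, .j1 q => (graphTK2 t).Adj p q
  | .j1 p, .j2 q => p ≠ q
  | .j2 p, .j2 q => (graphTK2 t)ᶜ.Adj p q
  | .j2 p, .j3 q => p ≠ q
  | .j3 p, .j3 q => (graphTK2 t).Adj p q
  | .j3 _, .right => True
  | _, _ => False

/-- The pointed graph `J`. -/
def graphJ (t : ℕ) : PointedGraph.{0} where
  V := JVert t
  graph := SimpleGraph.fromRel (JRel t)
  left := .left
  right := .right

/-! ### The pointed graph `R • Q^(n) • J` -/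

/-- The pointed graph `R • Q^(n) • J`. -/
noncomputable def graphRQJ (m : ℕ) {W : Type u} (H : SimpleGraph W) (t n : ℕ) :
    PointedGraph.{u} :=
  PointedGraph.glue (PointedGraph.glue (graphR m) (PointedGraph.pow (graphQ H) n)) (graphJ t)

/-!
A total dominating set of `P • Q` restricts to sets of vertices of `P` and of `Q`, and the only
interaction is at the common vertex. Either the restriction to `P` dominates `P` once Right is
given a loop, or the common vertex is not chosen and is dominated only from `Q`; the second
alternative can save one vertex in `P` but costs one more in `Q`. Hence the minimal sizes add up:
`R`, each copy of `Q`, and `J` contribute `3` each. After deleting a vertex of one of the factors,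
the loops at the ends of that factor are paid for by its neighbours, which have dominating sets of
the same cost with and without the common vertex. The common vertex separates the two factors and
Left and Right realise the diameter of each factor, so the diameters add up to `3 + 5 * n + 4`.
-/

/-! ### Domination with loops -/

section Domination

variable {V : Type*} {G : SimpleGraph V} {E : Set V} {S : Finset V} {x : V}

/-- The vertex `x` is adjacent to a vertex of `S`. -/
def IsTotallyDominated (G : SimpleGraph V) (S : Finset V) (x : V) : Prop :=
  ∃ s ∈ S, G.Adj x s

/-- Total domination in the graph `G` with loops added at the vertices of `E`, so that a vertex of
`E` is also dominated by itself. The loops record which vertices of a pointed graph may be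
dominated from outside, at the cost of one more vertex. -/
def IsLoopDominated (G : SimpleGraph V) (E : Set V) (S : Finset V) (x : V) : Prop :=
  IsTotallyDominated G S x ∨ x ∈ E ∧ x ∈ S

/-- `G` with loops at the vertices of `E` has total domination number at least `k`, and less than
`k` once any vertex without a loop is deleted. -/
structure IsLoopCritical (G : SimpleGraph V) (E : Set V) (k : ℕ) : Prop where
  le_card : ∀ S : Finset V, (∀ x, IsLoopDominated G E S x) → k ≤ S.card
  exists_delete : ∀ w ∉ E, ∃ S : Finset V,
    S.card < k ∧ w ∉ S ∧ ∀ x, x ≠ w → IsLoopDominated G E S x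

lemma isLoopDominated_iff_of_notMem (hx : x ∉ E) :
    IsLoopDominated G E S x ↔ IsTotallyDominated G S x :=
  or_iff_left fun h => hx h.1

lemma isLoopDominated_singleton_iff_of_notMem {y : V} (hy : y ∉ S) :
    IsLoopDominated G {y} S x ↔ IsTotallyDominated G S x :=
  or_iff_left fun h => hy (Set.mem_singleton_iff.1 h.1 ▸ h.2)

lemma isLoopDominated_empty : IsLoopDominated G ∅ S x ↔ IsTotallyDominated G S x :=
  isLoopDominated_iff_of_notMem (Set.notMem_empty x)

variable {V' : Type*} {G' : SimpleGraph V'}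

lemma isTotallyDominated_map (e : G ≃g G') :
    IsTotallyDominated G' (S.map e.toEquiv.toEmbedding) (e x) ↔ IsTotallyDominated G S x := by
  constructor
  · rintro ⟨s, hs, h⟩
    obtain ⟨t, ht, rfl⟩ := Finset.mem_map.1 hs
    exact ⟨t, ht, e.map_adj_iff.1 h⟩
  · rintro ⟨s, hs, h⟩
    exact ⟨e s, Finset.mem_map_of_mem _ hs, e.map_adj_iff.2 h⟩

lemma mem_map_iso (e : G ≃g G') : e x ∈ S.map e.toEquiv.toEmbedding ↔ x ∈ S :=
  Finset.mem_map' e.toEquiv.toEmbedding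

lemma isLoopDominated_map (e : G ≃g G') :
    IsLoopDominated G' (e '' E) (S.map e.toEquiv.toEmbedding) (e x) ↔
      IsLoopDominated G E S x :=
  or_congr (isTotallyDominated_map e)
    (and_congr (e.injective.mem_set_image) (mem_map_iso e))

lemma exists_eq_map_iso (e : G ≃g G') (T : Finset V') :
    ∃ S : Finset V, T = S.map e.toEquiv.toEmbedding :=
  ⟨T.map e.symm.toEquiv.toEmbedding, by simp [Finset.map_map]⟩

lemma IsLoopCritical.map {k : ℕ} (h : IsLoopCritical G E k) (e : G ≃g G') :
    IsLoopCritical G' (e '' E) k where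
  le_card T hT := by
    obtain ⟨S, rfl⟩ := exists_eq_map_iso e T
    rw [Finset.card_map]
    exact h.le_card S fun x => (isLoopDominated_map e).1 (hT (e x))
  exists_delete := by
    refine e.surjective.forall.2 fun w hw => ?_
    obtain ⟨S, hcard, hwS, hS⟩ := h.exists_delete w (mt (Set.mem_image_of_mem e) hw)
    refine ⟨S.map e.toEquiv.toEmbedding, by rwa [Finset.card_map], (mem_map_iso e).not.2 hwS,
      e.surjective.forall.2 fun x hx => ?_⟩
    exact (isLoopDominated_map e).2 (hS x fun h => hx (congrArg e h))

end Domination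

/-! ### Distances -/

section Distance

open SimpleGraph

variable {V V' : Type*} {G : SimpleGraph V} {G' : SimpleGraph V'}

lemma edist_map_le (f : G →g G') (x y : V) : G'.edist (f x) (f y) ≤ G.edist x y := by
  by_cases h : G.edist x y = ⊤
  · simp [h]
  · obtain ⟨p, hp⟩ := exists_walk_of_edist_ne_top h
    rw [← hp, ← p.length_map f]
    exact edist_le _

lemma le_add_edist_of_adj {ℓ : V → ℕ∞} (hℓ : ∀ x y, G.Adj x y → ℓ y ≤ ℓ x + 1) (x y : V) :
    ℓ y ≤ ℓ x + G.edist x y := by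
  by_cases h : G.edist x y = ⊤
  · simp [h]
  · obtain ⟨p, hp⟩ := exists_walk_of_edist_ne_top h
    rw [← hp]
    clear hp h
    induction p with
    | nil => simp
    | cons hadj p ih =>
      calc _ ≤ _ := ih
        _ ≤ _ := add_le_add_left (hℓ _ _ hadj) _
        _ = _ := by rw [Walk.length_cons]; push_cast; ring

lemma edist_le_edist_add_one {x y z : V} (h : G.Adj y z) : G.edist x z ≤ G.edist x y + 1 :=
  calc G.edist x z ≤ G.edist x y + G.edist y z := G.edist_triangle
    _ = G.edist x y + 1 := by rw [edist_eq_one_iff_adj.2 h]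

lemma edist_le_add_one_of_adj_left {x y z : V} {d : ℕ} (h : G.Adj x y) (hd : G.edist y z ≤ d) :
    G.edist x z ≤ (d + 1 : ℕ) := by
  rw [G.edist_comm] at hd ⊢
  push_cast
  exact (edist_le_edist_add_one h.symm).trans (add_le_add_left hd 1)

lemma edist_le_add_one_of_adj_right {x y z : V} {d : ℕ} (hd : G.edist x y ≤ d) (h : G.Adj y z) :
    G.edist x z ≤ (d + 1 : ℕ) := by
  push_cast
  exact (edist_le_edist_add_one h).trans (add_le_add_left hd 1)

/-- Two paths from `a` to `b`, one through `x` and one through `y`, form a closed walk of length at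
most `2 * d`. -/
lemma edist_le_of_edist_add_edist_le {a b : V} {d : ℕ}
    (h : ∀ x, G.edist a x + G.edist x b ≤ d) (x y : V) : G.edist x y ≤ d := by
  have hx := h x
  have hy := h y
  have ha : G.edist x y ≤ G.edist a x + G.edist a y := by
    rw [G.edist_comm (u := a) (v := x)]; exact G.edist_triangle
  have hb : G.edist x y ≤ G.edist x b + G.edist y b := by
    rw [G.edist_comm (u := y) (v := b)]; exact G.edist_triangle
  generalize G.edist x y = xy at *
  generalize G.edist a x = ax at *
  generalize G.edist a y = ay at *
  generalize G.edist x b = xb at *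
  generalize G.edist y b = yb at *
  lift ax to ℕ using by rintro rfl; simp at hx
  lift ay to ℕ using by rintro rfl; simp at hy
  lift xb to ℕ using by rintro rfl; simp at hx
  lift yb to ℕ using by rintro rfl; simp at hy
  lift xy to ℕ using by rintro rfl; simp at ha
  norm_cast at *
  lia

end Distance

namespace PointedGraph

/-- Left and Right are at distance `d`, which is the diameter. Extended distances are used so that
connectedness is part of the notion. -/
structure HasDiameter (P : PointedGraph.{u}) (d : ℕ) : Prop where
  edist_le : ∀ x y, P.graph.edist x y ≤ d
  le_edist_left_right : d ≤ P.graph.edist P.left P.right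

namespace HasDiameter

variable {P : PointedGraph.{u}} {d : ℕ}

lemma edist_left_right (h : P.HasDiameter d) : P.graph.edist P.left P.right = d :=
  (h.edist_le _ _).antisymm h.le_edist_left_right

lemma ediam (h : P.HasDiameter d) : P.graph.ediam = d :=
  (SimpleGraph.ediam_le_of_edist_le h.edist_le).antisymm
    (h.edist_left_right ▸ SimpleGraph.edist_le_ediam)

lemma diam (h : P.HasDiameter d) : P.graph.diam = d := by
  rw [SimpleGraph.diam, h.ediam, ENat.toNat_natCast]

lemma dist_left_right (h : P.HasDiameter d) : P.graph.dist P.left P.right = d := by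
  rw [SimpleGraph.dist, h.edist_left_right, ENat.toNat_natCast]

lemma isDiametrical (h : P.HasDiameter d) : P.IsDiametrical := by
  have : Nonempty P.V := ⟨P.left⟩
  exact ⟨SimpleGraph.connected_of_ediam_ne_top (h.ediam ▸ ENat.natCast_ne_top d),
    h.dist_left_right.trans h.diam.symm⟩

lemma right_ne_left (h : P.HasDiameter d) (hd : d ≠ 0) : P.right ≠ P.left := by
  intro h'
  have := h.edist_left_right
  rw [h', SimpleGraph.edist_self] at this
  exact hd (by exact_mod_cast this.symm)

lemma of_level {ℓ : P.V → ℕ} (edist_le : ∀ x y, P.graph.edist x y ≤ d)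
    (adj : ∀ x y, P.graph.Adj x y → ℓ y ≤ ℓ x + 1) (left : ℓ P.left = 0) (right : ℓ P.right = d) :
    P.HasDiameter d where
  edist_le := edist_le
  le_edist_left_right := by
    simpa [left, right] using le_add_edist_of_adj (ℓ := fun x => (ℓ x : ℕ∞))
      (fun x y h => by exact_mod_cast adj x y h) P.left P.right

lemma point : HasDiameter point.{u} 0 where
  edist_le _ _ := SimpleGraph.edist_self.le
  le_edist_left_right := by simp

end HasDiameter

end PointedGraph

/-! ### Gluing -/

namespace PointedGraph

variable {P : PointedGraph.{u}} {Q : PointedGraph.{v}}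

open Classical in
/-- The inclusion of the second factor of `P • Q`. -/
noncomputable def glueInr (P : PointedGraph.{u}) (Q : PointedGraph.{v}) (q : Q.V) :
    (glue P Q).V :=
  if h : q = Q.left then .inl P.right else .inr ⟨q, h⟩

/-- The inclusion of the first factor of `P • Q`. -/
def glueInl (P : PointedGraph.{u}) (Q : PointedGraph.{v}) (a : P.V) : (glue P Q).V :=
  .inl a

lemma glueInr_left : glueInr P Q Q.left = glueInl P Q P.right :=
  dif_pos rfl

lemma glueInr_of_ne {q : Q.V} (h : q ≠ Q.left) : glueInr P Q q = .inr ⟨q, h⟩ :=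
  dif_neg h

lemma glue_left : (glue P Q).left = glueInl P Q P.left := rfl

lemma glue_right : (glue P Q).right = glueInr P Q Q.right := rfl

lemma glueInl_injective : Function.Injective (glueInl P Q) := Sum.inl_injective

lemma glueInr_eq_glueInl {q : Q.V} {a : P.V} :
    glueInr P Q q = glueInl P Q a ↔ q = Q.left ∧ a = P.right := by
  by_cases hq : q = Q.left
  · rw [hq, glueInr_left, glueInl_injective.eq_iff]
    simp [eq_comm]
  · rw [glueInr_of_ne hq]
    exact ⟨fun h => absurd h Sum.inr_ne_inl, fun h => absurd h.1 hq⟩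

lemma glueInr_injective : Function.Injective (glueInr P Q) := by
  intro a b h
  by_cases hb : b = Q.left
  · rw [hb, glueInr_left, glueInr_eq_glueInl] at h
    rw [h.1, hb]
  · by_cases ha : a = Q.left
    · rw [ha, glueInr_left, eq_comm, glueInr_eq_glueInl] at h
      exact absurd h.1 hb
    · rw [glueInr_of_ne ha, glueInr_of_ne hb] at h
      exact congrArg Subtype.val (Sum.inr_injective h)

lemma glue_cases (w : (glue P Q).V) :
    (∃ a, w = glueInl P Q a) ∨ ∃ q, q ≠ Q.left ∧ w = glueInr P Q q := by
  rcases w with a | ⟨q, hq⟩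
  · exact .inl ⟨a, rfl⟩
  · exact .inr ⟨q, hq, (glueInr_of_ne hq).symm⟩

lemma glue_adj_inl {a b : P.V} :
    (glue P Q).graph.Adj (glueInl P Q a) (glueInl P Q b) ↔ P.graph.Adj a b := Iff.rfl

lemma glue_adj_inl_inr {a : P.V} {q : Q.V} (hq : q ≠ Q.left) :
    (glue P Q).graph.Adj (glueInl P Q a) (glueInr P Q q) ↔
      a = P.right ∧ Q.graph.Adj Q.left q := by
  rw [glueInr_of_ne hq]; rfl

lemma glue_adj_inr {q r : Q.V} :
    (glue P Q).graph.Adj (glueInr P Q q) (glueInr P Q r) ↔ Q.graph.Adj q r := by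
  by_cases hq : q = Q.left
  · by_cases hr : r = Q.left
    · simp [hq, hr]
    · rw [hq, glueInr_left, glue_adj_inl_inr hr]; simp
  · by_cases hr : r = Q.left
    · rw [hr, glueInr_left, SimpleGraph.adj_comm, glue_adj_inl_inr hq, SimpleGraph.adj_comm]; simp
    · rw [glueInr_of_ne hq, glueInr_of_ne hr]; rfl

/-- The inclusion of the first factor as a graph homomorphism. -/
def glueInlHom (P : PointedGraph.{u}) (Q : PointedGraph.{v}) :
    P.graph →g (glue P Q).graph where
  toFun := glueInl P Q
  map_rel' h := glue_adj_inl.2 h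

/-- The inclusion of the second factor as a graph homomorphism. -/
noncomputable def glueInrHom (P : PointedGraph.{u}) (Q : PointedGraph.{v}) :
    Q.graph →g (glue P Q).graph where
  toFun := glueInr P Q
  map_rel' h := glue_adj_inr.2 h

lemma glue_adj_inl_left_of_ne {a : P.V} (ha : a ≠ P.right) {w : (glue P Q).V}
    (h : (glue P Q).graph.Adj (glueInl P Q a) w) : ∃ b, w = glueInl P Q b ∧ P.graph.Adj a b := by
  rcases glue_cases w with ⟨b, rfl⟩ | ⟨q, hq, rfl⟩
  · exact ⟨b, rfl, glue_adj_inl.1 h⟩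
  · exact absurd ((glue_adj_inl_inr hq).1 h).1 ha

lemma glue_adj_inr_left_of_ne {q : Q.V} (hq : q ≠ Q.left) {w : (glue P Q).V}
    (h : (glue P Q).graph.Adj (glueInr P Q q) w) : ∃ r, w = glueInr P Q r ∧ Q.graph.Adj q r := by
  rcases glue_cases w with ⟨b, rfl⟩ | ⟨r, -, rfl⟩
  · obtain ⟨rfl, h'⟩ := (glue_adj_inl_inr hq).1 h.symm
    exact ⟨Q.left, glueInr_left.symm, h'.symm⟩
  · exact ⟨r, rfl, glue_adj_inr.1 h⟩

section Distance

lemma edist_glueInl_glueInl_le (a b : P.V) :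
    (glue P Q).graph.edist (glueInl P Q a) (glueInl P Q b) ≤ P.graph.edist a b :=
  edist_map_le (glueInlHom P Q) a b

lemma edist_glueInr_glueInr_le (q r : Q.V) :
    (glue P Q).graph.edist (glueInr P Q q) (glueInr P Q r) ≤ Q.graph.edist q r :=
  edist_map_le (glueInrHom P Q) q r

lemma edist_glueInl_glueInr (a : P.V) (q : Q.V) :
    (glue P Q).graph.edist (glueInl P Q a) (glueInr P Q q) =
      P.graph.edist a P.right + Q.graph.edist Q.left q := by
  apply le_antisymm
  · refine (SimpleGraph.edist_triangle (v := glueInl P Q P.right)).trans ?_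
    refine add_le_add (edist_glueInl_glueInl_le a P.right) ?_
    rw [← glueInr_left]
    exact edist_glueInr_glueInr_le Q.left q
  -- The right-hand side, as a function of the endpoint, changes by at most one along each edge.
  let ℓ : (glue P Q).V → ℕ∞ :=
    Sum.elim (P.graph.edist a) fun r => P.graph.edist a P.right + Q.graph.edist Q.left r
  have level_inl (b : P.V) : ℓ (glueInl P Q b) = P.graph.edist a b := rfl
  have level_inr (r : Q.V) :
      ℓ (glueInr P Q r) = P.graph.edist a P.right + Q.graph.edist Q.left r := by
    by_cases hr : r = Q.left
    · rw [hr, glueInr_left, level_inl, SimpleGraph.edist_self, add_zero]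
    · rw [glueInr_of_ne hr]; rfl
  have level_adj_inr (r s : Q.V) (h : Q.graph.Adj r s) :
      ℓ (glueInr P Q s) ≤ ℓ (glueInr P Q r) + 1 := by
    rw [level_inr, level_inr, add_assoc]
    exact add_le_add_right (edist_le_edist_add_one h) _
  have level_adj (x y : (glue P Q).V) (h : (glue P Q).graph.Adj x y) : ℓ y ≤ ℓ x + 1 := by
    rcases glue_cases x with ⟨b, rfl⟩ | ⟨r, hr, rfl⟩
    · rcases glue_cases y with ⟨c, rfl⟩ | ⟨s, hs, rfl⟩
      · exact edist_le_edist_add_one (glue_adj_inl.1 h)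
      · obtain ⟨rfl, hadj⟩ := (glue_adj_inl_inr hs).1 h
        rw [← glueInr_left]
        exact level_adj_inr _ _ hadj
    · obtain ⟨s, rfl, hadj⟩ := glue_adj_inr_left_of_ne hr h
      exact level_adj_inr _ _ hadj
  have h := le_add_edist_of_adj level_adj (glueInl P Q a) (glueInr P Q q)
  rwa [level_inr, level_inl, SimpleGraph.edist_self, zero_add] at h

lemma HasDiameter.glue {d e : ℕ} (hP : P.HasDiameter d) (hQ : Q.HasDiameter e) :
    (glue P Q).HasDiameter (d + e) where
  edist_le := by
    have inl_inr (a : P.V) (q : Q.V) :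
        (PointedGraph.glue P Q).graph.edist (glueInl P Q a) (glueInr P Q q) ≤ (d + e : ℕ) := by
      rw [edist_glueInl_glueInr, Nat.cast_add]
      exact add_le_add (hP.edist_le _ _) (hQ.edist_le _ _)
    intro x y
    rcases glue_cases x with ⟨a, rfl⟩ | ⟨q, -, rfl⟩ <;>
      rcases glue_cases y with ⟨b, rfl⟩ | ⟨r, -, rfl⟩
    · exact (edist_glueInl_glueInl_le a b).trans
        ((hP.edist_le a b).trans (by exact_mod_cast Nat.le_add_right d e))
    · exact inl_inr a r
    · rw [SimpleGraph.edist_comm]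
      exact inl_inr b q
    · exact (edist_glueInr_glueInr_le q r).trans
        ((hQ.edist_le q r).trans (by exact_mod_cast Nat.le_add_left e d))
  le_edist_left_right := by
    rw [glue_left, glue_right, edist_glueInl_glueInr, hP.edist_left_right, hQ.edist_left_right,
      Nat.cast_add]

lemma HasDiameter.pow {d : ℕ} (hP : P.HasDiameter d) : ∀ n, (pow P n).HasDiameter (n * d)
  | 0 => by rw [zero_mul]; exact .point
  | 1 => by rw [one_mul]; exact hP
  | n + 2 => by
    rw [add_mul n 2, two_mul, ← add_assoc, ← add_one_mul]
    exact (hP.pow (n + 1)).glue hP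

end Distance

open Classical in
lemma glue_exists_split (S : Finset (glue P Q).V) :
    ∃ (S₁ : Finset P.V) (S₂ : Finset Q.V), (∀ a, a ∈ S₁ ↔ glueInl P Q a ∈ S) ∧
      (∀ q, q ∈ S₂ ↔ glueInr P Q q ∈ S) ∧ S.card = S₁.card + (S₂.erase Q.left).card := by
  refine ⟨S.preimage _ glueInl_injective.injOn, S.preimage _ glueInr_injective.injOn,
    by simp, by simp, ?_⟩
  rw [← Finset.card_image_of_injective _ (glueInl_injective (P := P) (Q := Q)),
    ← Finset.card_image_of_injective _ (glueInr_injective (P := P) (Q := Q)),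
    ← Finset.card_union_of_disjoint]
  · congr 1
    ext w
    simp only [Finset.mem_union, Finset.mem_image, Finset.mem_preimage, Finset.mem_erase]
    constructor
    · intro hw
      rcases glue_cases w with ⟨b, rfl⟩ | ⟨r, hr, rfl⟩
      · exact .inl ⟨b, hw, rfl⟩
      · exact .inr ⟨r, ⟨hr, hw⟩, rfl⟩
    · rintro (⟨b, hb, rfl⟩ | ⟨r, ⟨-, hr⟩, rfl⟩) <;> assumption
  · simp only [Finset.disjoint_left, Finset.mem_image, Finset.mem_preimage, Finset.mem_erase]
    rintro _ ⟨a, -, rfl⟩ ⟨q, ⟨hq, -⟩, h⟩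
    exact hq (glueInr_eq_glueInl.1 h).1

open Classical in
/-- The union of sets of vertices of both factors of `P • Q`. -/
noncomputable def glueUnion (S₁ : Finset P.V) (S₂ : Finset Q.V) : Finset (glue P Q).V :=
  S₁.image (glueInl P Q) ∪ S₂.image (glueInr P Q)

section glueUnion

variable {S₁ : Finset P.V} {S₂ : Finset Q.V}

lemma glueInl_mem_glueUnion {a : P.V} :
    glueInl P Q a ∈ glueUnion S₁ S₂ ↔ a ∈ S₁ ∨ a = P.right ∧ Q.left ∈ S₂ := by
  classical
  simp only [glueUnion, Finset.mem_union, Finset.mem_image, glueInl_injective.eq_iff,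
    glueInr_eq_glueInl]
  aesop

lemma glueInr_mem_glueUnion {q : Q.V} :
    glueInr P Q q ∈ glueUnion S₁ S₂ ↔ q ∈ S₂ ∨ q = Q.left ∧ P.right ∈ S₁ := by
  classical
  simp only [glueUnion, Finset.mem_union, Finset.mem_image, glueInr_injective.eq_iff,
    eq_comm (a := glueInl P Q _), glueInr_eq_glueInl]
  aesop

lemma card_glueUnion_le : (glueUnion S₁ S₂).card ≤ S₁.card + S₂.card := by
  classical
  exact (Finset.card_union_le _ _).trans (add_le_add Finset.card_image_le Finset.card_image_le)

lemma card_glueUnion_lt (h₁ : P.right ∈ S₁) (h₂ : Q.left ∈ S₂) :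
    (glueUnion S₁ S₂).card < S₁.card + S₂.card := by
  classical
  have h := Finset.card_union_add_card_inter (S₁.image (glueInl P Q)) (S₂.image (glueInr P Q))
  have hpos : 0 < (S₁.image (glueInl P Q) ∩ S₂.image (glueInr P Q)).card :=
    Finset.card_pos.2 ⟨glueInl P Q P.right, Finset.mem_inter.2
      ⟨Finset.mem_image_of_mem _ h₁, glueInr_left (P := P) ▸ Finset.mem_image_of_mem _ h₂⟩⟩
  have e₁ := Finset.card_image_of_injective S₁ (glueInl_injective (P := P) (Q := Q))
  have e₂ := Finset.card_image_of_injective S₂ (glueInr_injective (P := P) (Q := Q))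
  unfold glueUnion
  lia

lemma isTotallyDominated_glueUnion_inl {a : P.V} (h : IsTotallyDominated P.graph S₁ a) :
    IsTotallyDominated (glue P Q).graph (glueUnion S₁ S₂) (glueInl P Q a) :=
  let ⟨_, hs, has⟩ := h
  ⟨_, glueInl_mem_glueUnion.2 (.inl hs), glue_adj_inl.2 has⟩

lemma isTotallyDominated_glueUnion_inr {q : Q.V} (h : IsTotallyDominated Q.graph S₂ q) :
    IsTotallyDominated (glue P Q).graph (glueUnion S₁ S₂) (glueInr P Q q) :=
  let ⟨_, hs, has⟩ := h
  ⟨_, glueInr_mem_glueUnion.2 (.inl hs), glue_adj_inr.2 has⟩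

lemma isLoopDominated_glueUnion {E : Set Q.V} {p : (glue P Q).V → Prop}
    (h_inl : ∀ a, a ≠ P.right → p (glueInl P Q a) → IsTotallyDominated P.graph S₁ a)
    (h_inr : ∀ q, q ≠ Q.left → p (glueInr P Q q) → IsLoopDominated Q.graph E S₂ q)
    (h_common : p (glueInl P Q P.right) →
      IsTotallyDominated P.graph S₁ P.right ∨ IsTotallyDominated Q.graph S₂ Q.left)
    (x : (glue P Q).V) (hx : p x) :
    IsLoopDominated (glue P Q).graph (glueInr P Q '' E) (glueUnion S₁ S₂) x := by
  rcases glue_cases x with ⟨a, rfl⟩ | ⟨q, hq, rfl⟩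
  · left
    by_cases ha : a = P.right
    · subst ha
      refine (h_common hx).elim isTotallyDominated_glueUnion_inl fun h => ?_
      rw [← glueInr_left]
      exact isTotallyDominated_glueUnion_inr h
    · exact isTotallyDominated_glueUnion_inl (h_inl a ha hx)
  · exact (h_inr q hq hx).imp isTotallyDominated_glueUnion_inr fun h =>
      ⟨Set.mem_image_of_mem _ h.1, glueInr_mem_glueUnion.2 (.inl h.2)⟩

lemma isTotallyDominated_glueUnion {p : (glue P Q).V → Prop}
    (h_inl : ∀ a, a ≠ P.right → p (glueInl P Q a) → IsTotallyDominated P.graph S₁ a)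
    (h_inr : ∀ q, q ≠ Q.left → p (glueInr P Q q) → IsTotallyDominated Q.graph S₂ q)
    (h_common : p (glueInl P Q P.right) →
      IsTotallyDominated P.graph S₁ P.right ∨ IsTotallyDominated Q.graph S₂ Q.left)
    (x : (glue P Q).V) (hx : p x) :
    IsTotallyDominated (glue P Q).graph (glueUnion S₁ S₂) x := by
  have h := isLoopDominated_glueUnion (E := ∅) h_inl (fun q hq h => .inl (h_inr q hq h)) h_common
    x hx
  rwa [Set.image_empty, isLoopDominated_empty] at h

end glueUnion

lemma isTotallyDominated_of_glue_inl {S : Finset (glue P Q).V} {S₁ : Finset P.V}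
    (h₁ : ∀ a, a ∈ S₁ ↔ glueInl P Q a ∈ S) {a : P.V} (ha : a ≠ P.right)
    (h : IsTotallyDominated (glue P Q).graph S (glueInl P Q a)) :
    IsTotallyDominated P.graph S₁ a := by
  obtain ⟨s, hs, h⟩ := h
  obtain ⟨b, rfl, hb⟩ := glue_adj_inl_left_of_ne ha h
  exact ⟨b, (h₁ b).2 hs, hb⟩

lemma isLoopDominated_of_glue_inr {S : Finset (glue P Q).V} {S₂ : Finset Q.V} {E : Set Q.V}
    (h₂ : ∀ q, q ∈ S₂ ↔ glueInr P Q q ∈ S) {q : Q.V} (hq : q ≠ Q.left)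
    (h : IsLoopDominated (glue P Q).graph (glueInr P Q '' E) S (glueInr P Q q)) :
    IsLoopDominated Q.graph E S₂ q := by
  rcases h with ⟨s, hs, h⟩ | ⟨hE, hS⟩
  · obtain ⟨b, rfl, hb⟩ := glue_adj_inr_left_of_ne hq h
    exact .inl ⟨b, (h₂ b).2 hs, hb⟩
  · exact .inr ⟨glueInr_injective.mem_set_image.1 hE, (h₂ q).2 hS⟩

lemma isTotallyDominated_of_glue_right {S : Finset (glue P Q).V} {S₁ : Finset P.V}
    {S₂ : Finset Q.V} (h₁ : ∀ a, a ∈ S₁ ↔ glueInl P Q a ∈ S)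
    (h₂ : ∀ q, q ∈ S₂ ↔ glueInr P Q q ∈ S)
    (h : IsTotallyDominated (glue P Q).graph S (glueInl P Q P.right)) :
    IsTotallyDominated P.graph S₁ P.right ∨ IsTotallyDominated Q.graph S₂ Q.left := by
  obtain ⟨s, hs, h⟩ := h
  rcases glue_cases s with ⟨b, rfl⟩ | ⟨r, hr, rfl⟩
  · exact .inl ⟨b, (h₁ b).2 hs, glue_adj_inl.1 h⟩
  · exact .inr ⟨r, (h₂ r).2 hs, ((glue_adj_inl_inr hr).1 h).2⟩

/-- Gluing is associative. -/
noncomputable def glueAssoc (A B C : PointedGraph) (hB : B.right ≠ B.left) :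
    (glue (glue A B) C).graph ≃g (glue A (glue B C)).graph where
  toFun
    | .inl (.inl a) => .inl a
    | .inl (.inr b) => .inr ⟨.inl b.1, fun h => b.2 (Sum.inl_injective h)⟩
    | .inr c => .inr ⟨.inr c, Sum.inr_ne_inl⟩
  invFun
    | .inl a => .inl (.inl a)
    | .inr ⟨.inl b, h⟩ => .inl (.inr ⟨b, fun hb => h (congrArg _ hb)⟩)
    | .inr ⟨.inr c, _⟩ => .inr c
  left_inv := by rintro ((a | b) | c) <;> rfl
  right_inv := by rintro (a | ⟨b | c, h⟩) <;> rfl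
  map_rel_iff' := by
    have hr : (glue A B).right = .inr ⟨B.right, hB⟩ := glueInr_of_ne hB
    have hr_inl (a : A.V) : (Sum.inl a : (glue A B).V) ≠ (glue A B).right := by
      rw [hr]; exact Sum.inl_ne_inr
    have hr_inr (b : {w : B.V // w ≠ B.left}) :
        (Sum.inr b : (glue A B).V) = (glue A B).right ↔ b.1 = B.right := by
      rw [hr]
      exact ⟨fun h => congrArg Subtype.val (Sum.inr_injective h),
        fun h => congrArg Sum.inr (Subtype.ext h)⟩
    rintro ((a | b) | c) ((a' | b') | c')
    · exact Iff.rfl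
    · exact Iff.rfl
    · exact ⟨fun h => absurd h.2.1.symm hB, fun h => absurd h.1 (hr_inl a)⟩
    · exact Iff.rfl
    · exact Iff.rfl
    · exact and_congr_left' (hr_inr b).symm
    · exact ⟨fun h => absurd h.2.1.symm hB, fun h => absurd h.1 (hr_inl a')⟩
    · exact and_congr_left' (hr_inr b').symm
    · exact Iff.rfl

lemma glueAssoc_right (A B C : PointedGraph) (hB : B.right ≠ B.left) (hC : C.right ≠ C.left) :
    glueAssoc A B C hB (glue (glue A B) C).right = (glue A (glue B C)).right := by
  have h : glueInr B C C.right ≠ glueInl B C B.left := by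
    rw [glueInr_of_ne hC]; exact Sum.inr_ne_inl
  have e : (glue A (glue B C)).right = .inr ⟨glueInr B C C.right, h⟩ := glueInr_of_ne h
  simp only [glue_right (P := glue A B), e, glueInr_of_ne hC]
  rfl

/-- The single vertex is neutral for gluing on the right. -/
def gluePoint (A : PointedGraph.{u}) : A.graph ≃g (glue A point.{v}).graph where
  toFun := glueInl A point
  invFun
    | .inl a => a
    | .inr b => (b.2 rfl).elim
  left_inv _ := rfl
  right_inv := by
    rintro (a | b)
    · rfl
    · exact (b.2 rfl).elim
  map_rel_iff' := Iff.rfl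

lemma gluePoint_right (A : PointedGraph.{u}) :
    gluePoint A A.right = (glue A point.{v}).right :=
  (glueInr_left (P := A) (Q := point)).symm

end PointedGraph

/-! ### Chains of pointed graphs -/

namespace PointedGraph

/-- The conditions on `P` under which gluing on the right is additive: `a` is the number of
vertices needed to dominate `P` when Right may be dominated by itself, and one vertex is saved when
Right is dominated from outside without being used. -/
structure IsChainPrefix (P : PointedGraph.{u}) (a : ℕ) : Prop where
  critical : IsLoopCritical P.graph {P.right} a
  le_card : ∀ S : Finset P.V, (∀ x, x ≠ P.right → IsTotallyDominated P.graph S x) →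
    a ≤ S.card + 1
  exists_mem : ∃ S : Finset P.V, S.card ≤ a ∧ P.right ∈ S ∧ ∀ x, IsTotallyDominated P.graph S x
  exists_notMem : ∃ S : Finset P.V, S.card < a ∧ P.right ∉ S ∧
    ∀ x, x ≠ P.right → IsTotallyDominated P.graph S x

/-- The conditions on `Q`, with loops at `E`, under which gluing `Q` to the right of an
`IsChainPrefix` increases the number of vertices needed by `c`. Left is either paid for by the
prefix, or is dominated by `Q` at the cost of one more vertex. -/
structure IsChainExtension (Q : PointedGraph.{u}) (c : ℕ) (E : Set Q.V) : Prop where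
  left_notMem : Q.left ∉ E
  le_card_erase [DecidableEq Q.V] : ∀ S : Finset Q.V,
    (∀ x, x ≠ Q.left → IsLoopDominated Q.graph E S x) → c ≤ (S.erase Q.left).card
  lt_card : ∀ S : Finset Q.V, Q.left ∉ S → (∀ x, IsLoopDominated Q.graph E S x) → c < S.card
  exists_mem : ∃ S : Finset Q.V, S.card ≤ c + 1 ∧ Q.left ∈ S ∧
    ∀ x, IsLoopDominated Q.graph E S x
  exists_notMem : ∃ S : Finset Q.V, S.card ≤ c ∧ Q.left ∉ S ∧
    ∀ x, x ≠ Q.left → IsLoopDominated Q.graph E S x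
  exists_delete : ∀ w ∉ E, w ≠ Q.left → ∃ S : Finset Q.V, S.card ≤ c ∧ w ∉ S ∧
    ∀ x, x ≠ w → IsLoopDominated Q.graph (insert Q.left E) S x

/-- The conditions on `Q` under which gluing `Q` turns an `IsChainPrefix` into another one. -/
structure IsChainLink (Q : PointedGraph.{u}) (c : ℕ) : Prop extends
    IsChainExtension Q c {Q.right} where
  le_card_erase_add_one [DecidableEq Q.V] : ∀ S : Finset Q.V,
    (∀ x, x ≠ Q.left → x ≠ Q.right → IsTotallyDominated Q.graph S x) →
      c ≤ (S.erase Q.left).card + 1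
  le_card : ∀ S : Finset Q.V, Q.left ∉ S →
    (∀ x, x ≠ Q.right → IsTotallyDominated Q.graph S x) → c ≤ S.card
  exists_mem_mem : ∃ S : Finset Q.V, S.card ≤ c + 1 ∧ Q.left ∈ S ∧ Q.right ∈ S ∧
    ∀ x, x ≠ Q.left → IsTotallyDominated Q.graph S x
  exists_mem_notMem : ∃ S : Finset Q.V, S.card ≤ c ∧ Q.left ∈ S ∧ Q.right ∉ S ∧
    ∀ x, x ≠ Q.left → x ≠ Q.right → IsTotallyDominated Q.graph S x

lemma IsChainPrefix.of_iso {P : PointedGraph.{u}} {P' : PointedGraph.{v}} {a : ℕ}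
    (h : IsChainPrefix P a) (e : P.graph ≃g P'.graph) (hr : e P.right = P'.right) :
    IsChainPrefix P' a where
  critical := by
    rw [← hr, ← Set.image_singleton]
    exact h.critical.map e
  le_card T hT := by
    obtain ⟨S, rfl⟩ := exists_eq_map_iso e T
    rw [Finset.card_map]
    exact h.le_card S fun x hx =>
      (isTotallyDominated_map e).1 (hT _ fun hex => hx (e.injective (hex.trans hr.symm)))
  exists_mem := by
    obtain ⟨S, hcard, hmem, hS⟩ := h.exists_mem
    exact ⟨S.map e.toEquiv.toEmbedding, by rwa [Finset.card_map], hr ▸ (mem_map_iso e).2 hmem,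
      e.surjective.forall.2 fun x => (isTotallyDominated_map e).2 (hS x)⟩
  exists_notMem := by
    obtain ⟨S, hcard, hmem, hS⟩ := h.exists_notMem
    refine ⟨S.map e.toEquiv.toEmbedding, by rwa [Finset.card_map],
      hr ▸ (mem_map_iso e).not.2 hmem, e.surjective.forall.2 fun x hx => ?_⟩
    exact (isTotallyDominated_map e).2 (hS x fun h => hx (h ▸ hr))

section Glue

variable {P : PointedGraph.{u}} {Q : PointedGraph.{v}} {a c k : ℕ} {E : Set Q.V}

open Classical in
lemma IsChainPrefix.add_le_card_add (hP : P.IsChainPrefix a) (hE : Q.left ∉ E) {D : Set Q.V}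
    (h_erase : ∀ T : Finset Q.V, (∀ q ∈ D, q ≠ Q.left → IsLoopDominated Q.graph E T q) →
      c ≤ (T.erase Q.left).card + k)
    (h_lt : ∀ T : Finset Q.V, Q.left ∉ T → IsTotallyDominated Q.graph T Q.left →
      (∀ q ∈ D, q ≠ Q.left → IsLoopDominated Q.graph E T q) → c < T.card + k)
    (S : Finset (glue P Q).V)
    (h_inl : ∀ b, IsLoopDominated (glue P Q).graph (glueInr P Q '' E) S (glueInl P Q b))
    (h_inr : ∀ q ∈ D, IsLoopDominated (glue P Q).graph (glueInr P Q '' E) S (glueInr P Q q)) :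
    a + c ≤ S.card + k := by
  obtain ⟨S₁, S₂, h₁, h₂, hcard⟩ := glue_exists_split S
  have total_inl (b : P.V) : IsTotallyDominated (glue P Q).graph S (glueInl P Q b) := by
    refine (isLoopDominated_iff_of_notMem ?_).1 (h_inl b)
    rintro ⟨q, hq, h⟩
    exact hE ((glueInr_eq_glueInl.1 h).1 ▸ hq)
  have dom₁ (b : P.V) (hb : b ≠ P.right) : IsTotallyDominated P.graph S₁ b :=
    isTotallyDominated_of_glue_inl h₁ hb (total_inl b)
  have dom₂ (q : Q.V) (hD : q ∈ D) (hq : q ≠ Q.left) : IsLoopDominated Q.graph E S₂ q :=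
    isLoopDominated_of_glue_inr h₂ hq (h_inr q hD)
  by_cases hr : IsLoopDominated P.graph {P.right} S₁ P.right
  · have := hP.critical.le_card S₁ fun b => by
      by_cases hb : b = P.right
      · exact hb ▸ hr
      · exact .inl (dom₁ b hb)
    have := h_erase S₂ dom₂
    lia
  · simp only [IsLoopDominated, Set.mem_singleton_iff, true_and, not_or] at hr
    have hleft : Q.left ∉ S₂ := by rw [h₂, glueInr_left, ← h₁]; exact hr.2
    have := hP.le_card S₁ dom₁
    have := h_lt S₂ hleft
      ((isTotallyDominated_of_glue_right h₁ h₂ (total_inl _)).resolve_left hr.1) dom₂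
    rw [Finset.erase_eq_of_notMem hleft] at hcard
    lia

lemma IsChainPrefix.exists_glue_delete_inl (hP : P.IsChainPrefix a) (hQ : Q.IsChainExtension c E)
    {b : P.V} (hb : b ≠ P.right) :
    ∃ S : Finset (glue P Q).V, S.card < a + c ∧ glueInl P Q b ∉ S ∧
      ∀ x, x ≠ glueInl P Q b → IsLoopDominated (glue P Q).graph (glueInr P Q '' E) S x := by
  obtain ⟨S₁, hcard₁, hbS₁, hS₁⟩ := hP.critical.exists_delete b hb
  have dom₁ (x : P.V) (hx : x ≠ P.right) (hxb : glueInl P Q x ≠ glueInl P Q b) :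
      IsTotallyDominated P.graph S₁ x :=
    (isLoopDominated_iff_of_notMem (E := {P.right}) hx).1 (hS₁ x (ne_of_apply_ne _ hxb))
  have notMem (S₂ : Finset Q.V) : glueInl P Q b ∉ glueUnion S₁ S₂ := by
    simp only [glueInl_mem_glueUnion, hbS₁, hb, false_and, or_self, not_false_eq_true]
  by_cases hr : P.right ∈ S₁
  · obtain ⟨S₂, hcard₂, hl, hS₂⟩ := hQ.exists_mem
    have := card_glueUnion_lt hr hl
    exact ⟨glueUnion S₁ S₂, by lia, notMem S₂, isLoopDominated_glueUnion dom₁ (fun q _ _ => hS₂ q)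
      fun _ => .inr ((isLoopDominated_iff_of_notMem hQ.left_notMem).1 (hS₂ _))⟩
  · obtain ⟨S₂, hcard₂, -, hS₂⟩ := hQ.exists_notMem
    have := card_glueUnion_le (S₁ := S₁) (S₂ := S₂)
    refine ⟨glueUnion S₁ S₂, by lia, notMem S₂,
      isLoopDominated_glueUnion dom₁ (fun q hq _ => hS₂ q hq) fun _ => .inl ?_⟩
    exact (hS₁ P.right hb.symm).resolve_right fun h => hr h.2

lemma IsChainPrefix.exists_glue_delete_right (hP : P.IsChainPrefix a)
    (hQ : Q.IsChainExtension c E) :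
    ∃ S : Finset (glue P Q).V, S.card < a + c ∧ glueInl P Q P.right ∉ S ∧
      ∀ x, x ≠ glueInl P Q P.right →
        IsLoopDominated (glue P Q).graph (glueInr P Q '' E) S x := by
  obtain ⟨S₁, hcard₁, hr, hS₁⟩ := hP.exists_notMem
  obtain ⟨S₂, hcard₂, hl, hS₂⟩ := hQ.exists_notMem
  have := card_glueUnion_le (S₁ := S₁) (S₂ := S₂)
  exact ⟨glueUnion S₁ S₂, by lia, fun h => (glueInl_mem_glueUnion.1 h).elim hr fun h => hl h.2,
    isLoopDominated_glueUnion (fun x hx _ => hS₁ x hx) (fun q hq _ => hS₂ q hq)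
      fun h => absurd rfl h⟩

lemma IsChainPrefix.exists_glue_delete_inr (hP : P.IsChainPrefix a) (hQ : Q.IsChainExtension c E)
    {q : Q.V} (hq : q ≠ Q.left) (hqE : q ∉ E) :
    ∃ S : Finset (glue P Q).V, S.card < a + c ∧ glueInr P Q q ∉ S ∧
      ∀ x, x ≠ glueInr P Q q → IsLoopDominated (glue P Q).graph (glueInr P Q '' E) S x := by
  obtain ⟨S₂, hcard₂, hqS₂, hS₂⟩ := hQ.exists_delete q hqE hq
  have dom₂ (x : Q.V) (hx : x ≠ Q.left) (hxq : glueInr P Q x ≠ glueInr P Q q) :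
      IsLoopDominated Q.graph E S₂ x :=
    (hS₂ x (ne_of_apply_ne _ hxq)).imp_right (.imp_left (·.resolve_left hx))
  have notMem (S₁ : Finset P.V) : glueInr P Q q ∉ glueUnion S₁ S₂ := by
    simp only [glueInr_mem_glueUnion, hqS₂, hq, false_and, or_self, not_false_eq_true]
  by_cases hl : Q.left ∈ S₂
  · obtain ⟨S₁, hcard₁, hr, hS₁⟩ := hP.exists_mem
    have := card_glueUnion_lt hr hl
    exact ⟨glueUnion S₁ S₂, by lia, notMem S₁,
      isLoopDominated_glueUnion (fun x _ _ => hS₁ x) dom₂ fun _ => .inl (hS₁ _)⟩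
  · obtain ⟨S₁, hcard₁, -, hS₁⟩ := hP.exists_notMem
    have := card_glueUnion_le (S₁ := S₁) (S₂ := S₂)
    refine ⟨glueUnion S₁ S₂, by lia, notMem S₁,
      isLoopDominated_glueUnion (fun x hx _ => hS₁ x hx) dom₂ fun _ => .inr ?_⟩
    exact (hS₂ Q.left hq.symm).resolve_right fun h => hl h.2

theorem IsChainPrefix.isLoopCritical_glue (hP : P.IsChainPrefix a)
    (hQ : Q.IsChainExtension c E) :
    IsLoopCritical (glue P Q).graph (glueInr P Q '' E) (a + c) where
  le_card S hS := by
    classical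
    refine hP.add_le_card_add (k := 0) (D := Set.univ) hQ.left_notMem ?_ ?_ S (fun _ => hS _)
      fun _ _ => hS _
    · exact fun T hT => hQ.le_card_erase T fun q hq => hT q trivial hq
    · refine fun T hl hl' hT => hQ.lt_card T hl fun q => ?_
      by_cases hq : q = Q.left
      · exact hq ▸ .inl hl'
      · exact hT q trivial hq
  exists_delete w hw := by
    rcases glue_cases w with ⟨b, rfl⟩ | ⟨q, hq, rfl⟩
    · by_cases hb : b = P.right
      · exact hb ▸ hP.exists_glue_delete_right hQ
      · exact hP.exists_glue_delete_inl hQ hb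
    · exact hP.exists_glue_delete_inr hQ hq (mt (Set.mem_image_of_mem _) hw)

theorem IsChainPrefix.glue (hP : P.IsChainPrefix a) (hQ : Q.IsChainLink c) :
    (glue P Q).IsChainPrefix (a + c) where
  critical := by
    rw [glue_right, ← Set.image_singleton]
    exact hP.isLoopCritical_glue hQ.toIsChainExtension
  le_card S hS := by
    classical
    have hlr : Q.left ≠ Q.right := hQ.left_notMem
    have dom {x : (PointedGraph.glue P Q).V} (hx : x ≠ (PointedGraph.glue P Q).right) :
        IsLoopDominated (PointedGraph.glue P Q).graph (glueInr P Q '' ∅) S x := .inl (hS x hx)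
    refine hP.add_le_card_add (k := 1) (D := {Q.right}ᶜ) (Set.notMem_empty _) ?_ ?_ S
      (fun b => dom fun h => hlr (glueInr_eq_glueInl.1 h.symm).1.symm)
      fun q hq => dom (glueInr_injective.ne hq)
    · exact fun T hT => hQ.le_card_erase_add_one T fun q hq hqr =>
        isLoopDominated_empty.1 (hT q hqr hq)
    · refine fun T hl hl' hT => Nat.lt_succ_of_le (hQ.le_card T hl fun q hqr => ?_)
      by_cases hq : q = Q.left
      · exact hq ▸ hl'
      · exact isLoopDominated_empty.1 (hT q hqr hq)
  exists_mem := by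
    obtain ⟨S₁, hcard₁, hr, hS₁⟩ := hP.exists_mem
    obtain ⟨S₂, hcard₂, hl, hr₂, hS₂⟩ := hQ.exists_mem_mem
    have := card_glueUnion_lt hr hl
    exact ⟨glueUnion S₁ S₂, by lia, glueInr_mem_glueUnion.2 (.inl hr₂), fun x =>
      isTotallyDominated_glueUnion (p := fun _ => True) (fun y _ _ => hS₁ y)
        (fun q hq _ => hS₂ q hq) (fun _ => .inl (hS₁ _)) x trivial⟩
  exists_notMem := by
    obtain ⟨S₁, hcard₁, hr, hS₁⟩ := hP.exists_mem
    obtain ⟨S₂, hcard₂, hl, hr₂, hS₂⟩ := hQ.exists_mem_notMem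
    have := card_glueUnion_lt hr hl
    refine ⟨glueUnion S₁ S₂, by lia, ?_, isTotallyDominated_glueUnion (fun y _ _ => hS₁ y)
      (fun q hq hqr => hS₂ q hq (ne_of_apply_ne _ hqr)) fun _ => .inl (hS₁ _)⟩
    exact fun h => (glueInr_mem_glueUnion.1 h).elim hr₂ fun h => hQ.left_notMem h.1.symm

theorem IsChainPrefix.glue_pow {d : ℕ} (hP : P.IsChainPrefix a) (hQ : Q.IsChainLink c)
    (hd : Q.HasDiameter d) (hd₀ : d ≠ 0) :
    ∀ n, (PointedGraph.glue P (pow Q n)).IsChainPrefix (a + n * c)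
  | 0 => by
    rw [zero_mul]
    exact hP.of_iso (gluePoint P) (gluePoint_right P)
  | 1 => by
    rw [one_mul]
    exact hP.glue hQ
  | n + 2 => by
    have hne := (hd.pow (n + 1)).right_ne_left (mul_ne_zero n.succ_ne_zero hd₀)
    rw [add_mul n 2, two_mul, ← add_assoc (n * c), ← add_one_mul, ← add_assoc]
    exact ((hP.glue_pow hQ hd hd₀ (n + 1)).glue hQ).of_iso (glueAssoc P (pow Q (n + 1)) Q hne)
      (glueAssoc_right _ _ _ _ (hd.right_ne_left hd₀))

end Glue

end PointedGraph

/-! ### Total domination numbers -/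

section TotalDominationNumber

variable {V : Type*} {G : SimpleGraph V} {S : Finset V} {k : ℕ}

lemma totalDominationNumber_le (h : IsTotalDominatingSet G S) :
    totalDominationNumber G ≤ S.card :=
  iInf₂_le S h

lemma exists_pair_of_totalDominationNumber_eq_two (h : totalDominationNumber G = 2) :
    ∃ a b, ∀ w, G.Adj w a ∨ G.Adj w b := by
  classical
  obtain ⟨S, hS, hlt⟩ : ∃ S, ∃ _ : IsTotalDominatingSet G S, (S.card : ℕ∞) < 3 := by
    have h_lt_three : totalDominationNumber G < 3 := by rw [h]; norm_num
    simpa only [totalDominationNumber, iInf_lt_iff] using h_lt_three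
  have hle := totalDominationNumber_le hS
  rw [h] at hle
  have hcard : S.card = 2 :=
    (Nat.le_of_lt_succ (by exact_mod_cast hlt)).antisymm (by exact_mod_cast hle)
  obtain ⟨a, b, -, rfl⟩ := Finset.card_eq_two.1 hcard
  exact ⟨a, b, fun w => by simpa using hS w⟩

lemma isTotalDominatingSet_insert [DecidableEq V] {w x : V} (hwx : G.Adj w x)
    (hS : ∀ y, y ≠ w → IsTotallyDominated G S y) : IsTotalDominatingSet G (insert x S) := by
  intro y
  by_cases hy : y = w
  · exact ⟨x, Finset.mem_insert_self _ _, hy ▸ hwx⟩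
  · obtain ⟨s, hs, hadj⟩ := hS y hy
    exact ⟨s, Finset.mem_insert_of_mem hs, hadj⟩

lemma exists_isTotalDominatingSet_deleteVertex {w : V} (hw : w ∉ S)
    (hS : ∀ y, y ≠ w → IsTotallyDominated G S y) :
    ∃ T, IsTotalDominatingSet (deleteVertex G w) T ∧ T.card = S.card := by
  classical
  have mem_compl : ∀ x ∈ S, x ∈ ({w}ᶜ : Set V) := fun x hx hxw => hw (hxw ▸ hx)
  refine ⟨S.subtype (· ∈ ({w}ᶜ : Set V)), fun y => ?_, ?_⟩
  · obtain ⟨s, hs, hadj⟩ := hS y.1 y.2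
    exact ⟨⟨s, mem_compl s hs⟩, Finset.mem_subtype.2 hs, hadj⟩
  · rw [Finset.card_subtype, Finset.filter_true_of_mem mem_compl]

namespace IsLoopCritical

lemma exists_delete_of_empty (h : IsLoopCritical G ∅ k) (w : V) :
    ∃ S : Finset V, S.card < k ∧ w ∉ S ∧ ∀ x, x ≠ w → IsTotallyDominated G S x := by
  simpa only [isLoopDominated_empty] using h.exists_delete w (Set.notMem_empty w)

lemma le_card_of_isTotalDominatingSet (h : IsLoopCritical G ∅ k)
    (hS : IsTotalDominatingSet G S) : k ≤ S.card :=
  h.le_card S fun x => .inl (hS x)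

variable [Nontrivial V]

lemma exists_adj (h : IsLoopCritical G ∅ k) (w : V) : ∃ x, G.Adj w x := by
  obtain ⟨w', hw'⟩ := exists_ne w
  obtain ⟨S, -, -, hS⟩ := h.exists_delete_of_empty w'
  obtain ⟨s, -, hs⟩ := hS w hw'.symm
  exact ⟨s, hs⟩

lemma exists_deleteVertex (h : IsLoopCritical G ∅ (k + 1)) (w : V) :
    ∃ S, IsTotalDominatingSet (deleteVertex G w) S ∧ S.card = k := by
  classical
  obtain ⟨S, hcard, hw, hS⟩ := h.exists_delete_of_empty w
  obtain ⟨x, hwx⟩ := h.exists_adj w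
  have hle := h.le_card_of_isTotalDominatingSet (isTotalDominatingSet_insert hwx hS)
  obtain ⟨T, hT, hTS⟩ := exists_isTotalDominatingSet_deleteVertex hw hS
  exact ⟨T, hT, by have := Finset.card_insert_le x S; lia⟩

lemma totalDominationNumber_eq (h : IsLoopCritical G ∅ k) : totalDominationNumber G = k := by
  classical
  refine le_antisymm ?_ (le_iInf₂ fun S hS => by
    exact_mod_cast h.le_card_of_isTotalDominatingSet hS)
  obtain ⟨w⟩ : Nonempty V := inferInstance
  obtain ⟨x, hwx⟩ := h.exists_adj w
  obtain ⟨S, hcard, -, hS⟩ := h.exists_delete_of_empty w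
  refine (totalDominationNumber_le (isTotalDominatingSet_insert hwx hS)).trans ?_
  exact_mod_cast (Finset.card_insert_le x S).trans hcard

lemma isTotalDominationVertexCritical (h : IsLoopCritical G ∅ (k + 1)) :
    IsTotalDominationVertexCritical G (k + 1) := by
  refine ⟨h.totalDominationNumber_eq, fun w _ => ?_⟩
  obtain ⟨S, hS, hcard⟩ := h.exists_deleteVertex w
  rw [h.totalDominationNumber_eq]
  refine (totalDominationNumber_le hS).trans_lt ?_
  rw [hcard]
  exact_mod_cast k.lt_succ_self

end IsLoopCritical

end TotalDominationNumber

lemma PointedGraph.HasDiameter.nontrivial {P : PointedGraph.{u}} {d : ℕ} (h : P.HasDiameter d)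
    (hd : d ≠ 0) : Nontrivial P.V :=
  ⟨P.right, P.left, h.right_ne_left hd⟩

/-! ### The graph `Q` -/

namespace QVert

variable {W : Type u} {H : SimpleGraph W} {S : Finset (QVert W)} {a : W}

lemma exists_iff {p : QVert W → Prop} : (∃ x, p x) ↔ p left ∨ (∃ w, p (x1 w)) ∨
    (∃ w, p (y1 w)) ∨ (∃ w, p (x2 w)) ∨ (∃ w, p (y2 w)) ∨ p right := by
  constructor
  · rintro ⟨_ | w | w | w | w | _, h⟩ <;> grind
  · grind

lemma isTotallyDominated_left : IsTotallyDominated (SimpleGraph.fromRel (QRel H)) S left ↔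
    ∃ b, x1 b ∈ S := by
  simp [IsTotallyDominated, exists_iff, QRel]

lemma isTotallyDominated_x1 : IsTotallyDominated (SimpleGraph.fromRel (QRel H)) S (x1 a) ↔
    left ∈ S ∨ (∃ b, x1 b ∈ S ∧ H.Adj a b) ∨ ∃ b, y1 b ∈ S ∧ a ≠ b := by
  grind [IsTotallyDominated, exists_iff, SimpleGraph.fromRel_adj, QRel, H.adj_comm, H.ne_of_adj]

lemma isTotallyDominated_y1 : IsTotallyDominated (SimpleGraph.fromRel (QRel H)) S (y1 a) ↔
    (∃ b, x1 b ∈ S ∧ a ≠ b) ∨ (∃ b, y1 b ∈ S ∧ Hᶜ.Adj a b) ∨ ∃ b, x2 b ∈ S := by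
  grind [IsTotallyDominated, exists_iff, SimpleGraph.fromRel_adj, QRel, Hᶜ.adj_comm, Hᶜ.ne_of_adj]

lemma isTotallyDominated_x2 : IsTotallyDominated (SimpleGraph.fromRel (QRel H)) S (x2 a) ↔
    (∃ b, y1 b ∈ S) ∨ (∃ b, x2 b ∈ S ∧ H.Adj a b) ∨ ∃ b, y2 b ∈ S ∧ a ≠ b := by
  grind [IsTotallyDominated, exists_iff, SimpleGraph.fromRel_adj, QRel, H.adj_comm, H.ne_of_adj]

lemma isTotallyDominated_y2 : IsTotallyDominated (SimpleGraph.fromRel (QRel H)) S (y2 a) ↔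
    (∃ b, x2 b ∈ S ∧ a ≠ b) ∨ (∃ b, y2 b ∈ S ∧ Hᶜ.Adj a b) ∨ right ∈ S := by
  grind [IsTotallyDominated, exists_iff, SimpleGraph.fromRel_adj, QRel, Hᶜ.adj_comm, Hᶜ.ne_of_adj]

lemma isTotallyDominated_right : IsTotallyDominated (SimpleGraph.fromRel (QRel H)) S right ↔
    ∃ b, y2 b ∈ S := by
  simp [IsTotallyDominated, exists_iff, QRel]

section LowerBound

lemma two_le_card [DecidableEq (QVert W)] [Nonempty W]
    (h : ∀ x, x ≠ left → x ≠ right → IsTotallyDominated (SimpleGraph.fromRel (QRel H)) S x) :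
    2 ≤ ((S.erase left).erase right).card := by
  obtain ⟨w⟩ := ‹Nonempty W›
  have dom_y1 := fun a => isTotallyDominated_y1.1 (h (y1 a) (by simp) (by simp))
  have dom_x2 := fun a => isTotallyDominated_x2.1 (h (x2 a) (by simp) (by simp))
  by_contra hcard
  have eq_of_mem (c d : QVert W) (hc : c ∈ S ∧ c ≠ left ∧ c ≠ right)
      (hd : d ∈ S ∧ d ≠ left ∧ d ≠ right) : c = d := by
    by_contra hcd
    exact hcard (Finset.one_lt_card.2 ⟨c, by grind, d, by grind, hcd⟩)
  rcases dom_y1 w with ⟨b, hb, -⟩ | ⟨b, hb, -⟩ | ⟨b, hb⟩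
  · have := dom_x2 b
    grind
  · have := dom_y1 b
    grind [Hᶜ.ne_of_adj]
  · have := dom_x2 b
    grind [H.ne_of_adj]

lemma three_le_card_of_left [DecidableEq (QVert W)]
    (h : ∀ x, x ≠ right → IsTotallyDominated (SimpleGraph.fromRel (QRel H)) S x)
    (hl : left ∉ S) : 3 ≤ (S.erase right).card := by
  obtain ⟨a, ha⟩ := isTotallyDominated_left.1 (h left (by simp))
  have dom_x1 := fun a => (isTotallyDominated_x1.1 (h (x1 a) (by simp))).resolve_left hl
  have dom_y1 := fun a => isTotallyDominated_y1.1 (h (y1 a) (by simp))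
  have dom_x2 := isTotallyDominated_x2.1 (h (x2 a) (by simp))
  by_contra hcard
  have eq_of_mem (d e : QVert W) (hd : d ∈ S ∧ d ≠ x1 a ∧ d ≠ right)
      (he : e ∈ S ∧ e ≠ x1 a ∧ e ≠ right) : d = e := by
    by_contra hde
    exact hcard (Finset.two_lt_card.2 ⟨x1 a, by grind, d, by grind, e, by grind, by grind⟩)
  have dom_x1_a := dom_x1 a
  rcases dom_x2 with ⟨b, hb⟩ | ⟨b, hb, -⟩ | ⟨b, hb, -⟩
  · have y1_mem (c : W) (hc : y1 c ∈ S) : c = b := by grind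
    have x1_mem (c : W) (hc : x1 c ∈ S) : c = a := by grind
    have hab : a ≠ b := by grind [H.ne_of_adj]
    have h_adj : H.Adj b a := by
      have := dom_x1 b
      grind
    have h_compl_adj : Hᶜ.Adj a b := by
      have := dom_y1 a
      grind
    exact h_compl_adj.2 h_adj.symm
  · grind [H.ne_of_adj]
  · grind [H.ne_of_adj]

lemma three_le_card_of_right [DecidableEq (QVert W)]
    (h : ∀ x, x ≠ left → IsTotallyDominated (SimpleGraph.fromRel (QRel H)) S x)
    (hr : right ∉ S) : 3 ≤ (S.erase left).card := by
  obtain ⟨a, ha⟩ := isTotallyDominated_right.1 (h right (by simp))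
  have dom_y1 := isTotallyDominated_y1.1 (h (y1 a) (by simp))
  have dom_x2 := fun a => isTotallyDominated_x2.1 (h (x2 a) (by simp))
  have dom_y2 := fun a => isTotallyDominated_y2.1 (h (y2 a) (by simp))
  simp only [hr, or_false] at dom_y2
  by_contra hcard
  have eq_of_mem (d e : QVert W) (hd : d ∈ S ∧ d ≠ y2 a ∧ d ≠ left)
      (he : e ∈ S ∧ e ≠ y2 a ∧ e ≠ left) : d = e := by
    by_contra hde
    exact hcard (Finset.two_lt_card.2 ⟨y2 a, by grind, d, by grind, e, by grind, by grind⟩)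
  have dom_y2_a := dom_y2 a
  rcases dom_y1 with ⟨b, hb, -⟩ | ⟨b, hb, -⟩ | ⟨b, hb⟩
  · grind [Hᶜ.ne_of_adj]
  · grind [Hᶜ.ne_of_adj]
  · have x2_mem (c : W) (hc : x2 c ∈ S) : c = b := by grind
    have y2_mem (c : W) (hc : y2 c ∈ S) : c = a := by grind
    have hab : a ≠ b := by grind [Hᶜ.ne_of_adj]
    have h_compl_adj : Hᶜ.Adj b a := by
      have := dom_y2 b
      grind
    have h_adj : H.Adj a b := by
      have := dom_x2 a
      grind
    exact h_compl_adj.2 h_adj.symm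

lemma four_le_card (h : ∀ x, IsTotallyDominated (SimpleGraph.fromRel (QRel H)) S x)
    (hl : left ∉ S) (hr : right ∉ S) : 4 ≤ S.card := by
  obtain ⟨a, ha⟩ := isTotallyDominated_left.1 (h left)
  obtain ⟨b, hb⟩ := isTotallyDominated_right.1 (h right)
  have dom_x1 := (isTotallyDominated_x1.1 (h (x1 a))).resolve_left hl
  have dom_y2 := isTotallyDominated_y2.1 (h (y2 b))
  simp only [hr, or_false] at dom_y2
  rcases dom_x1 with ⟨c, hc, hac⟩ | ⟨c, hc, hac⟩ <;>
    rcases dom_y2 with ⟨d, hd, hbd⟩ | ⟨d, hd, hbd⟩ <;>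
    exact Finset.three_lt_card.2 ⟨x1 a, ha, y2 b, hb, _, hc, _, hd, by
      grind [H.ne_of_adj, Hᶜ.ne_of_adj]⟩

lemma three_le_card_erase_left [DecidableEq (QVert W)] [Nonempty W]
    (h : ∀ x, x ≠ left → IsLoopDominated (SimpleGraph.fromRel (QRel H)) {right} S x) :
    3 ≤ (S.erase left).card := by
  by_cases hr : right ∈ S
  · have := two_le_card (H := H) (S := S) fun x hx hx' =>
      (isLoopDominated_iff_of_notMem (E := {right}) hx').1 (h x hx)
    have := Finset.card_erase_add_one (Finset.mem_erase.2 ⟨by simp, hr⟩ : right ∈ S.erase left)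
    lia
  · exact three_le_card_of_right
      (fun x hx => (isLoopDominated_singleton_iff_of_notMem hr).1 (h x hx)) hr

lemma three_lt_card (hl : left ∉ S)
    (h : ∀ x, IsLoopDominated (SimpleGraph.fromRel (QRel H)) {right} S x) : 3 < S.card := by
  classical
  by_cases hr : right ∈ S
  · have := three_le_card_of_left (H := H) (fun x hx =>
      (isLoopDominated_iff_of_notMem (E := {right}) hx).1 (h x)) hl
    have := Finset.card_erase_add_one hr
    lia
  · exact four_le_card (fun x => (isLoopDominated_singleton_iff_of_notMem hr).1 (h x)) hl hr

end LowerBound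

section UpperBound

lemma exists_card_le_four_of_adj {a b : W} (hab : H.Adj a b) :
    ∃ S : Finset (QVert W), S.card ≤ 4 ∧ left ∈ S ∧ right ∈ S ∧
      ∀ x, x ≠ left → IsTotallyDominated (SimpleGraph.fromRel (QRel H)) S x := by
  classical
  refine ⟨{left, x2 a, y2 b, right}, Finset.card_le_four, by simp, by simp, ?_⟩
  rintro (_ | w | w | w | w | _) hx <;>
    grind [isTotallyDominated_x1, isTotallyDominated_y1, isTotallyDominated_x2,
      isTotallyDominated_y2, isTotallyDominated_right, H.adj_comm, H.ne_of_adj]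

lemma exists_card_le_four_of_compl_adj {a b : W} (hab : Hᶜ.Adj a b) :
    ∃ S : Finset (QVert W), S.card ≤ 4 ∧ left ∈ S ∧ right ∈ S ∧
      ∀ x, x ≠ right → IsTotallyDominated (SimpleGraph.fromRel (QRel H)) S x := by
  classical
  refine ⟨{left, x1 a, y1 b, right}, Finset.card_le_four, by simp, by simp, ?_⟩
  rintro (_ | w | w | w | w | _) hx <;>
    grind [isTotallyDominated_left, isTotallyDominated_x1, isTotallyDominated_y1,
      isTotallyDominated_x2, isTotallyDominated_y2, Hᶜ.adj_comm, Hᶜ.ne_of_adj]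

lemma exists_left_mem_right_notMem {a b : W} (h : ∀ w, H.Adj w a ∨ H.Adj w b) :
    ∃ S : Finset (QVert W), S.card ≤ 3 ∧ left ∈ S ∧ right ∉ S ∧
      ∀ x, x ≠ left → x ≠ right → IsTotallyDominated (SimpleGraph.fromRel (QRel H)) S x := by
  classical
  have hab : H.Adj a b := (h a).resolve_left H.irrefl
  refine ⟨{left, x2 a, x2 b}, Finset.card_le_three, by simp, by simp, ?_⟩
  rintro (_ | w | w | w | w | _) hx hx' <;>
    grind [isTotallyDominated_x1, isTotallyDominated_y1, isTotallyDominated_x2,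
      isTotallyDominated_y2, H.ne_of_adj]

lemma exists_left_notMem_right_mem {a b : W} (h : ∀ w, Hᶜ.Adj w a ∨ Hᶜ.Adj w b) :
    ∃ S : Finset (QVert W), S.card ≤ 3 ∧ left ∉ S ∧ right ∈ S ∧
      ∀ x, x ≠ left → x ≠ right → IsTotallyDominated (SimpleGraph.fromRel (QRel H)) S x := by
  classical
  have hab : Hᶜ.Adj a b := (h a).resolve_left Hᶜ.irrefl
  refine ⟨{right, y1 a, y1 b}, Finset.card_le_three, by simp, by simp, ?_⟩
  rintro (_ | w | w | w | w | _) hx hx' <;>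
    grind [isTotallyDominated_x1, isTotallyDominated_y1, isTotallyDominated_x2,
      isTotallyDominated_y2, Hᶜ.ne_of_adj]

lemma exists_delete_x1 {a b : W} (hab : Hᶜ.Adj a b) :
    ∃ S : Finset (QVert W), S.card ≤ 3 ∧ x1 a ∉ S ∧ ∀ x, x ≠ x1 a →
      IsLoopDominated (SimpleGraph.fromRel (QRel H)) {left, right} S x := by
  classical
  refine ⟨{x1 b, y1 a, right}, Finset.card_le_three, by grind [Hᶜ.ne_of_adj], ?_⟩
  rintro (_ | w | w | w | w | _) hx <;>
    grind [IsLoopDominated, isTotallyDominated_left, isTotallyDominated_x1,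
      isTotallyDominated_y1, isTotallyDominated_x2, isTotallyDominated_y2,
      Hᶜ.adj_comm, Hᶜ.ne_of_adj]

lemma exists_delete_y1 {a b : W} (hab : H.Adj a b) :
    ∃ S : Finset (QVert W), S.card ≤ 3 ∧ y1 a ∉ S ∧ ∀ x, x ≠ y1 a →
      IsLoopDominated (SimpleGraph.fromRel (QRel H)) {left, right} S x := by
  classical
  refine ⟨{x1 a, y1 b, right}, Finset.card_le_three, by grind [H.ne_of_adj], ?_⟩
  rintro (_ | w | w | w | w | _) hx <;>
    grind [IsLoopDominated, isTotallyDominated_left, isTotallyDominated_x1,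
      isTotallyDominated_y1, isTotallyDominated_x2, isTotallyDominated_y2,
      H.adj_comm, H.ne_of_adj]

lemma exists_delete_x2 {a b : W} (hab : Hᶜ.Adj a b) :
    ∃ S : Finset (QVert W), S.card ≤ 3 ∧ x2 a ∉ S ∧ ∀ x, x ≠ x2 a →
      IsLoopDominated (SimpleGraph.fromRel (QRel H)) {left, right} S x := by
  classical
  refine ⟨{y2 a, x2 b, left}, Finset.card_le_three, by grind [Hᶜ.ne_of_adj], ?_⟩
  rintro (_ | w | w | w | w | _) hx <;>
    grind [IsLoopDominated, isTotallyDominated_x1, isTotallyDominated_y1,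
      isTotallyDominated_x2, isTotallyDominated_y2, isTotallyDominated_right,
      Hᶜ.adj_comm, Hᶜ.ne_of_adj]

lemma exists_delete_y2 {a b : W} (hab : H.Adj a b) :
    ∃ S : Finset (QVert W), S.card ≤ 3 ∧ y2 a ∉ S ∧ ∀ x, x ≠ y2 a →
      IsLoopDominated (SimpleGraph.fromRel (QRel H)) {left, right} S x := by
  classical
  refine ⟨{y2 b, x2 a, left}, Finset.card_le_three, by grind [H.ne_of_adj], ?_⟩
  rintro (_ | w | w | w | w | _) hx <;>
    grind [IsLoopDominated, isTotallyDominated_x1, isTotallyDominated_y1,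
      isTotallyDominated_x2, isTotallyDominated_y2, isTotallyDominated_right,
      H.adj_comm, H.ne_of_adj]

lemma exists_delete (h : ∀ a, ∃ b, H.Adj a b) (h_compl : ∀ a, ∃ b, Hᶜ.Adj a b) {v : QVert W}
    (hl : v ≠ left) (hr : v ≠ right) :
    ∃ S : Finset (QVert W), S.card ≤ 3 ∧ v ∉ S ∧ ∀ x, x ≠ v →
      IsLoopDominated (SimpleGraph.fromRel (QRel H)) {left, right} S x := by
  rcases v with _ | a | a | a | a | _
  exacts [absurd rfl hl, (h_compl a).elim fun _ => exists_delete_x1,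
    (h a).elim fun _ => exists_delete_y1, (h_compl a).elim fun _ => exists_delete_x2,
    (h a).elim fun _ => exists_delete_y2, absurd rfl hr]

end UpperBound

section Distance

/-- The distance from Left. -/
def level : QVert W → ℕ
  | left => 0
  | x1 _ => 1
  | y1 _ => 2
  | x2 _ => 3
  | y2 _ => 4
  | right => 5

lemma level_le_of_adj (x y : QVert W) (h : (SimpleGraph.fromRel (QRel H)).Adj x y) :
    level y ≤ level x + 1 := by
  rcases x with _ | _ | _ | _ | _ | _ <;> rcases y with _ | _ | _ | _ | _ | _ <;>
    simp [QRel, level] at h ⊢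

variable [Nontrivial W]

lemma edist_left_le : ∀ x, (SimpleGraph.fromRel (QRel H)).edist left x ≤ level x := by
  have edist_x1 (a : W) : (SimpleGraph.fromRel (QRel H)).edist left (x1 a) ≤ (1 : ℕ) :=
    edist_le_add_one_of_adj_right (y := left) (d := 0) (by simp) (by simp [QRel])
  have edist_y1 (a : W) : (SimpleGraph.fromRel (QRel H)).edist left (y1 a) ≤ (2 : ℕ) := by
    obtain ⟨b, hb⟩ := exists_ne a
    exact edist_le_add_one_of_adj_right (edist_x1 b) (by simpa [QRel] using hb)
  obtain ⟨w⟩ : Nonempty W := inferInstance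
  have edist_x2 (a : W) : (SimpleGraph.fromRel (QRel H)).edist left (x2 a) ≤ (3 : ℕ) :=
    edist_le_add_one_of_adj_right (edist_y1 w) (by simp [QRel])
  have edist_y2 (a : W) : (SimpleGraph.fromRel (QRel H)).edist left (y2 a) ≤ (4 : ℕ) := by
    obtain ⟨b, hb⟩ := exists_ne a
    exact edist_le_add_one_of_adj_right (edist_x2 b) (by simpa [QRel] using hb)
  rintro (_ | a | a | a | a | _)
  exacts [by simp, edist_x1 a, edist_y1 a, edist_x2 a, edist_y2 a,
    edist_le_add_one_of_adj_right (edist_y2 w) (by simp [QRel])]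

lemma edist_right_le :
    ∀ x, (SimpleGraph.fromRel (QRel H)).edist x right ≤ (5 - level x : ℕ) := by
  have edist_y2 (a : W) : (SimpleGraph.fromRel (QRel H)).edist (y2 a) right ≤ (1 : ℕ) :=
    edist_le_add_one_of_adj_left (y := right) (d := 0) (by simp [QRel]) (by simp)
  have edist_x2 (a : W) : (SimpleGraph.fromRel (QRel H)).edist (x2 a) right ≤ (2 : ℕ) := by
    obtain ⟨b, hb⟩ := exists_ne a
    exact edist_le_add_one_of_adj_left (by simpa [QRel] using hb.symm) (edist_y2 b)
  obtain ⟨w⟩ : Nonempty W := inferInstance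
  have edist_y1 (a : W) : (SimpleGraph.fromRel (QRel H)).edist (y1 a) right ≤ (3 : ℕ) :=
    edist_le_add_one_of_adj_left (by simp [QRel]) (edist_x2 w)
  have edist_x1 (a : W) : (SimpleGraph.fromRel (QRel H)).edist (x1 a) right ≤ (4 : ℕ) := by
    obtain ⟨b, hb⟩ := exists_ne a
    exact edist_le_add_one_of_adj_left (by simpa [QRel] using hb.symm) (edist_y1 b)
  rintro (_ | a | a | a | a | _)
  exacts [edist_le_add_one_of_adj_left (by simp [QRel]) (edist_x1 w), edist_x1 a, edist_y1 a,
    edist_x2 a, edist_y2 a, by simp]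

lemma edist_left_add_edist_right_le (x : QVert W) :
    (SimpleGraph.fromRel (QRel H)).edist left x + (SimpleGraph.fromRel (QRel H)).edist x right ≤
      (5 : ℕ) := by
  refine (add_le_add (edist_left_le x) (edist_right_le x)).trans ?_
  have level_le : level x ≤ 5 := by cases x <;> simp [level]
  exact_mod_cast (Nat.add_sub_of_le level_le).le

end Distance

end QVert

open QVert in
lemma graphQ_hasDiameter {W : Type u} [Nontrivial W] (H : SimpleGraph W) :
    (graphQ H).HasDiameter 5 :=
  .of_level (ℓ := level) (edist_le_of_edist_add_edist_le edist_left_add_edist_right_le)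
    level_le_of_adj rfl rfl

open QVert in
lemma graphQ_isChainLink {W : Type u} {H : SimpleGraph W}
    (hH : ∃ a b, ∀ w, H.Adj w a ∨ H.Adj w b) (hHc : ∃ a b, ∀ w, Hᶜ.Adj w a ∨ Hᶜ.Adj w b) :
    (graphQ H).IsChainLink 3 := by
  obtain ⟨a, b, hab⟩ := hH
  obtain ⟨c, d, hcd⟩ := hHc
  have adj_ab : H.Adj a b := (hab a).resolve_left H.irrefl
  have adj_cd : Hᶜ.Adj c d := (hcd c).resolve_left Hᶜ.irrefl
  have : Nonempty W := ⟨a⟩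
  exact {
    left_notMem := nofun
    le_card_erase := @fun (_ : DecidableEq (QVert W)) _ hS => three_le_card_erase_left hS
    lt_card := fun _ => three_lt_card
    exists_mem := by
      obtain ⟨S, hcard, hl, hr, hS⟩ := exists_card_le_four_of_compl_adj adj_cd
      refine ⟨S, hcard, hl, fun x => ?_⟩
      by_cases hx : x = right
      · exact .inr ⟨hx, hx ▸ hr⟩
      · exact .inl (hS x hx)
    exists_notMem := by
      obtain ⟨S, hcard, hl, hr, hS⟩ := exists_left_notMem_right_mem hcd
      refine ⟨S, hcard, hl, fun x hx => ?_⟩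
      by_cases hx' : x = right
      · exact .inr ⟨hx', hx' ▸ hr⟩
      · exact .inl (hS x hx hx')
    exists_delete := fun v hr hl => exists_delete (fun w => (hab w).elim (⟨a, ·⟩) (⟨b, ·⟩))
      (fun w => (hcd w).elim (⟨c, ·⟩) (⟨d, ·⟩)) hl hr
    le_card_erase_add_one := @fun (_ : DecidableEq (QVert W)) _ hS =>
      Nat.add_le_add_right ((two_le_card hS).trans Finset.card_erase_le) 1
    le_card := by
      classical
      intro S hl hS
      exact (three_le_card_of_left hS hl).trans Finset.card_erase_le
    exists_mem_mem := exists_card_le_four_of_adj adj_ab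
    exists_mem_notMem := exists_left_mem_right_notMem hab }

/-! ### The graph `R` -/

namespace RVert

variable {m : ℕ} {S : Finset (RVert m)} {i j : Fin (2 * m)}

lemma exists_iff {p : RVert m → Prop} : (∃ s, p s) ↔ (∃ i, p (x i)) ∨ (∃ i, p (y i)) ∨
    p z1 ∨ p z2 ∨ p z3 ∨ p left ∨ p right := by
  constructor
  · rintro ⟨i | i | _ | _ | _ | _ | _, h⟩ <;> grind
  · grind

lemma graphF_adj : (graphF m).Adj i j ↔ i.val % 2 ≠ j.val % 2 ∧
    ¬ (i.val = 0 ∧ j.val + 1 = 2 * m) ∧ ¬ (j.val = 0 ∧ i.val + 1 = 2 * m) := Iff.rfl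

lemma isTotallyDominated_left : IsTotallyDominated (SimpleGraph.fromRel (RRel m)) S left ↔
    ∃ j, x j ∈ S := by
  simp [IsTotallyDominated, exists_iff, RRel]

lemma isTotallyDominated_x : IsTotallyDominated (SimpleGraph.fromRel (RRel m)) S (x i) ↔
    (∃ j, x j ∈ S ∧ i ≠ j ∧ ¬ (graphF m).Adj i j) ∨ (∃ j, y j ∈ S ∧ i ≠ j) ∨
      (z1 ∈ S ∧ i.val + 1 ≠ 2 * m) ∨ (z2 ∈ S ∧ i.val ≠ 0) ∨ left ∈ S := by
  grind [IsTotallyDominated, exists_iff, SimpleGraph.fromRel_adj, RRel, (graphF m).adj_comm,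
    SimpleGraph.compl_adj]

lemma isTotallyDominated_y : IsTotallyDominated (SimpleGraph.fromRel (RRel m)) S (y i) ↔
    (∃ j, x j ∈ S ∧ i ≠ j) ∨ (∃ j, y j ∈ S ∧ i.val % 2 ≠ j.val % 2) ∨
      (z1 ∈ S ∧ i.val ≠ 0 ∧ i.val + 1 ≠ 2 * m) ∨ (z2 ∈ S ∧ i.val ≠ 0 ∧ i.val + 1 ≠ 2 * m) ∨
      z3 ∈ S ∨ right ∈ S := by
  grind [IsTotallyDominated, exists_iff, SimpleGraph.fromRel_adj, RRel, graphK]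

lemma isTotallyDominated_z1 : IsTotallyDominated (SimpleGraph.fromRel (RRel m)) S z1 ↔
    (∃ j, x j ∈ S ∧ j.val + 1 ≠ 2 * m) ∨ (∃ j, y j ∈ S ∧ j.val ≠ 0 ∧ j.val + 1 ≠ 2 * m) ∨
      z3 ∈ S := by
  simp [IsTotallyDominated, exists_iff, RRel]

lemma isTotallyDominated_z2 : IsTotallyDominated (SimpleGraph.fromRel (RRel m)) S z2 ↔
    (∃ j, x j ∈ S ∧ j.val ≠ 0) ∨ (∃ j, y j ∈ S ∧ j.val ≠ 0 ∧ j.val + 1 ≠ 2 * m) ∨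
      right ∈ S := by
  simp [IsTotallyDominated, exists_iff, RRel]

lemma isTotallyDominated_z3 : IsTotallyDominated (SimpleGraph.fromRel (RRel m)) S z3 ↔
    (∃ j, y j ∈ S) ∨ z1 ∈ S := by
  simp [IsTotallyDominated, exists_iff, RRel]

lemma isTotallyDominated_right : IsTotallyDominated (SimpleGraph.fromRel (RRel m)) S right ↔
    (∃ j, y j ∈ S) ∨ z2 ∈ S := by
  simp [IsTotallyDominated, exists_iff, RRel]

section LowerBound

lemma two_le_card [DecidableEq (RVert m)]
    (h : ∀ s, s ≠ right → IsTotallyDominated (SimpleGraph.fromRel (RRel m)) S s) :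
    2 ≤ (S.erase right).card := by
  obtain ⟨i, hi⟩ := isTotallyDominated_left.1 (h left (by simp))
  obtain ⟨d, hd, h_adj⟩ := h (x i) (by simp)
  have hdr : d ≠ right := by
    rintro rfl
    simp [RRel] at h_adj
  exact Finset.one_lt_card.2 ⟨x i, by simp [hi], d, by simp [hd, hdr], h_adj.ne⟩

lemma not_forall_isTotallyDominated_pair [DecidableEq (RVert m)] :
    ¬ ∀ s, IsTotallyDominated (SimpleGraph.fromRel (RRel m)) {x i, y j} s := by
  intro h
  -- Dominating `x j` and `y i` makes `{i, j}` the edge removed from `K_{m,m}`, and then `z1` or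
  -- `z2` has no neighbour in `{x i, y j}`.
  have dom_x := fun i => isTotallyDominated_x.1 (h (x i))
  have dom_y := isTotallyDominated_y.1 (h (y i))
  have dom_z1 := isTotallyDominated_z1.1 (h z1)
  have dom_z2 := isTotallyDominated_z2.1 (h z2)
  have hij : i ≠ j := by simpa using dom_x i
  have h_adj : ¬ (graphF m).Adj j i := by simpa [hij.symm] using dom_x j
  have h_parity : i.val % 2 ≠ j.val % 2 := by simpa using dom_y
  simp only [graphF_adj] at h_adj
  simp only [Finset.mem_insert, Finset.mem_singleton, x.injEq, y.injEq, reduceCtorEq, or_false,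
    false_or, exists_eq_left] at dom_z1 dom_z2
  lia

lemma three_le_card (h : ∀ s, IsTotallyDominated (SimpleGraph.fromRel (RRel m)) S s) :
    3 ≤ S.card := by
  classical
  obtain ⟨i, hi⟩ := isTotallyDominated_left.1 (h left)
  rcases isTotallyDominated_right.1 (h right) with ⟨j, hj⟩ | hz
  · by_contra hcard
    refine not_forall_isTotallyDominated_pair (i := i) (j := j) ?_
    rwa [Finset.eq_of_subset_of_card_le (s := {x i, y j}) (t := S) (by grind)
      (by rw [Finset.card_pair (by simp)]; lia)]
  · rcases isTotallyDominated_z3.1 (h z3) with ⟨j, hj⟩ | hj <;>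
      exact Finset.two_lt_card.2 ⟨_, hi, _, hz, _, hj, by simp, by simp, by simp⟩

lemma three_le_card_of_isLoopDominated
    (h : ∀ s, IsLoopDominated (SimpleGraph.fromRel (RRel m)) {right} S s) : 3 ≤ S.card := by
  classical
  by_cases hr : right ∈ S
  · have := two_le_card (S := S) fun s hs =>
      (isLoopDominated_iff_of_notMem (E := {right}) hs).1 (h s)
    have := Finset.card_erase_add_one hr
    lia
  · exact three_le_card fun s => (isLoopDominated_singleton_iff_of_notMem hr).1 (h s)

end LowerBound

lemma exists_mod_two_eq_ne (hm : 2 ≤ m) (p : ℕ) (i : Fin (2 * m)) :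
    ∃ k : Fin (2 * m), k.val % 2 = p % 2 ∧ k ≠ i :=
  ⟨⟨if p % 2 = 0 then (if i.val = 0 then 2 else 0) else (if i.val = 1 then 3 else 1),
    by split_ifs <;> lia⟩, by grind⟩

lemma exists_mod_two_eq_interior (hm : 2 ≤ m) (p : ℕ) :
    ∃ k : Fin (2 * m), k.val % 2 = p % 2 ∧ k.val ≠ 0 ∧ k.val + 1 ≠ 2 * m :=
  ⟨⟨if p % 2 = 0 then 2 else 1, by split <;> lia⟩, by grind⟩

section UpperBound

lemma isTotallyDominated_pair [DecidableEq (RVert m)] (hij : i ≠ j) {s : RVert m}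
    (hx : s = x j → ¬ (graphF m).Adj j i) (hy : s = y i → i.val % 2 ≠ j.val % 2)
    (hz1 : s = z1 → i.val + 1 ≠ 2 * m ∨ j.val ≠ 0 ∧ j.val + 1 ≠ 2 * m)
    (hz2 : s = z2 → i.val ≠ 0 ∨ j.val ≠ 0 ∧ j.val + 1 ≠ 2 * m) :
    IsTotallyDominated (SimpleGraph.fromRel (RRel m)) {x i, y j} s := by
  rcases s with l | l | _ | _ | _ | _ | _ <;>
    simp only [isTotallyDominated_left, isTotallyDominated_x, isTotallyDominated_y,
      isTotallyDominated_z1, isTotallyDominated_z2, isTotallyDominated_z3,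
      isTotallyDominated_right, Finset.mem_insert, Finset.mem_singleton] <;>
    grind

variable (hm : 2 ≤ m)
include hm

lemma exists_delete_x (i : Fin (2 * m)) :
    ∃ S : Finset (RVert m), S.card ≤ 2 ∧ x i ∉ S ∧
      ∀ s, s ≠ x i → IsTotallyDominated (SimpleGraph.fromRel (RRel m)) S s := by
  classical
  obtain ⟨k, h_parity, h_first, h_last⟩ := exists_mod_two_eq_interior hm (i.val + 1)
  have hki : k ≠ i := by grind
  refine ⟨{x k, y i}, Finset.card_le_two, by simpa using hki.symm, fun s hs => ?_⟩
  exact isTotallyDominated_pair hki (fun h => absurd h hs) (fun _ => by lia)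
    (fun _ => .inl h_last) (fun _ => .inl h_first)

lemma exists_delete_y (i : Fin (2 * m)) :
    ∃ S : Finset (RVert m), S.card ≤ 2 ∧ y i ∉ S ∧
      ∀ s, s ≠ y i → IsTotallyDominated (SimpleGraph.fromRel (RRel m)) S s := by
  classical
  obtain ⟨k, h_parity, hki⟩ := exists_mod_two_eq_ne hm i.val i
  refine ⟨{x i, y k}, Finset.card_le_two, by simpa using hki.symm, fun s hs => ?_⟩
  exact isTotallyDominated_pair hki.symm (fun _ h => h.1 h_parity) (fun h => absurd h hs)
    (fun _ => by lia) (fun _ => by lia)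

lemma exists_delete_z1 :
    ∃ S : Finset (RVert m), S.card ≤ 2 ∧ z1 ∉ S ∧
      ∀ s, s ≠ z1 → IsTotallyDominated (SimpleGraph.fromRel (RRel m)) S s := by
  classical
  refine ⟨{x ⟨2 * m - 1, by lia⟩, y ⟨0, by lia⟩}, Finset.card_le_two, by simp, fun s hs => ?_⟩
  exact isTotallyDominated_pair (by grind) (by grind [graphF_adj])
    (by grind) (fun h => absurd h hs) (by grind)

lemma exists_delete_z2 :
    ∃ S : Finset (RVert m), S.card ≤ 2 ∧ z2 ∉ S ∧
      ∀ s, s ≠ z2 → IsTotallyDominated (SimpleGraph.fromRel (RRel m)) S s := by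
  classical
  refine ⟨{x ⟨0, by lia⟩, y ⟨2 * m - 1, by lia⟩}, Finset.card_le_two, by simp, fun s hs => ?_⟩
  exact isTotallyDominated_pair (by grind) (by grind [graphF_adj])
    (by grind) (by grind) (fun h => absurd h hs)

lemma exists_delete_z3 :
    ∃ S : Finset (RVert m), S.card ≤ 2 ∧ z3 ∉ S ∧
      ∀ s, s ≠ z3 → IsTotallyDominated (SimpleGraph.fromRel (RRel m)) S s := by
  classical
  obtain ⟨a, ha⟩ : ∃ i : Fin (2 * m), i.val = 2 := ⟨⟨2, by lia⟩, rfl⟩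
  refine ⟨{z2, x a}, Finset.card_le_two, by simp, ?_⟩
  rintro (l | l | _ | _ | _ | _ | _) hs <;>
    grind [isTotallyDominated_left, isTotallyDominated_x, isTotallyDominated_y,
      isTotallyDominated_z1, isTotallyDominated_z2, isTotallyDominated_right, graphF_adj]

lemma exists_delete_left :
    ∃ S : Finset (RVert m), S.card ≤ 2 ∧ left ∉ S ∧
      ∀ s, s ≠ left → IsTotallyDominated (SimpleGraph.fromRel (RRel m)) S s := by
  classical
  obtain ⟨a, ha⟩ : ∃ i : Fin (2 * m), i.val = 0 := ⟨⟨0, by lia⟩, rfl⟩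
  obtain ⟨b, hb⟩ : ∃ i : Fin (2 * m), i.val = 1 := ⟨⟨1, by lia⟩, rfl⟩
  refine ⟨{y a, y b}, Finset.card_le_two, by simp, ?_⟩
  rintro (l | l | _ | _ | _ | _ | _) hs <;>
    grind [isTotallyDominated_x, isTotallyDominated_y, isTotallyDominated_z1,
      isTotallyDominated_z2, isTotallyDominated_z3, isTotallyDominated_right]

lemma exists_delete {s : RVert m} (hr : s ≠ right) :
    ∃ S : Finset (RVert m), S.card ≤ 2 ∧ s ∉ S ∧
      ∀ s', s' ≠ s → IsTotallyDominated (SimpleGraph.fromRel (RRel m)) S s' := by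
  rcases s with i | i | _ | _ | _ | _ | _
  exacts [exists_delete_x hm i, exists_delete_y hm i, exists_delete_z1 hm, exists_delete_z2 hm,
    exists_delete_z3 hm, exists_delete_left hm, absurd rfl hr]

lemma exists_right_mem : ∃ S : Finset (RVert m), S.card ≤ 3 ∧ right ∈ S ∧
    ∀ s, IsTotallyDominated (SimpleGraph.fromRel (RRel m)) S s := by
  classical
  obtain ⟨a, ha⟩ : ∃ i : Fin (2 * m), i.val = 0 := ⟨⟨0, by lia⟩, rfl⟩
  obtain ⟨b, hb⟩ : ∃ i : Fin (2 * m), i.val = 2 := ⟨⟨2, by lia⟩, rfl⟩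
  refine ⟨{right, x a, y b}, Finset.card_le_three, by simp, ?_⟩
  rintro (l | l | _ | _ | _ | _ | _) <;>
    grind [isTotallyDominated_left, isTotallyDominated_x, isTotallyDominated_y,
      isTotallyDominated_z1, isTotallyDominated_z2, isTotallyDominated_z3,
      isTotallyDominated_right, graphF_adj]

lemma exists_right_notMem : ∃ S : Finset (RVert m), S.card ≤ 2 ∧ right ∉ S ∧
    ∀ s, s ≠ right → IsTotallyDominated (SimpleGraph.fromRel (RRel m)) S s := by
  classical
  obtain ⟨a, ha⟩ : ∃ i : Fin (2 * m), i.val = 1 := ⟨⟨1, by lia⟩, rfl⟩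
  refine ⟨{z1, x a}, Finset.card_le_two, by simp, ?_⟩
  rintro (l | l | _ | _ | _ | _ | _) hs <;>
    grind [isTotallyDominated_left, isTotallyDominated_x, isTotallyDominated_y,
      isTotallyDominated_z1, isTotallyDominated_z2, isTotallyDominated_z3, graphF_adj]

end UpperBound

section Distance

/-- The distance from Left. -/
def level : RVert m → ℕ
  | left => 0
  | x _ => 1
  | y _ => 2
  | z1 => 2
  | z2 => 2
  | z3 => 3
  | right => 3

lemma level_le_of_adj (s s' : RVert m) (h : (SimpleGraph.fromRel (RRel m)).Adj s s') :
    level s' ≤ level s + 1 := by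
  rcases s with _ | _ | _ | _ | _ | _ | _ <;> rcases s' with _ | _ | _ | _ | _ | _ | _ <;>
    simp [RRel, level] at h ⊢

variable (hm : 2 ≤ m)
include hm

lemma exists_adj_y {s : RVert m} (hl : s ≠ left) (hs : ∀ i, s ≠ y i) (j : Fin (2 * m)) :
    ∃ i, (SimpleGraph.fromRel (RRel m)).Adj s (y i) ∧
      (SimpleGraph.fromRel (RRel m)).Adj (y i) (y j) := by
  obtain ⟨a, ha, ha_first, ha_last⟩ := exists_mod_two_eq_interior hm (j.val + 1)
  have hay : (SimpleGraph.fromRel (RRel m)).Adj (y a) (y j) := by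
    grind [SimpleGraph.fromRel_adj, RRel, graphK]
  rcases s with i | i | _ | _ | _ | _ | _
  · obtain ⟨b, hb, hbi⟩ := exists_mod_two_eq_ne hm (j.val + 1) i
    exact ⟨b, by simpa [RRel] using hbi.symm, by grind [SimpleGraph.fromRel_adj, RRel, graphK]⟩
  · exact absurd rfl (hs i)
  · exact ⟨a, by simp [RRel, ha_first, ha_last], hay⟩
  · exact ⟨a, by simp [RRel, ha_first, ha_last], hay⟩
  · exact ⟨a, by simp [RRel], hay⟩
  · exact absurd rfl hl
  · exact ⟨a, by simp [RRel], hay⟩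

lemma edist_left_le : ∀ s, (SimpleGraph.fromRel (RRel m)).edist left s ≤ (3 : ℕ) := by
  have edist_x (i : Fin (2 * m)) : (SimpleGraph.fromRel (RRel m)).edist left (x i) ≤ (1 : ℕ) :=
    edist_le_add_one_of_adj_right (y := left) (d := 0) (by simp) (by simp [RRel])
  have edist_y (i : Fin (2 * m)) : (SimpleGraph.fromRel (RRel m)).edist left (y i) ≤ (2 : ℕ) := by
    obtain ⟨k, -, hk⟩ := exists_mod_two_eq_ne hm 0 i
    exact edist_le_add_one_of_adj_right (edist_x k) (by simpa [RRel] using hk)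
  obtain ⟨a, -, ha_first, ha_last⟩ := exists_mod_two_eq_interior hm 0
  have edist_z1 : (SimpleGraph.fromRel (RRel m)).edist left z1 ≤ (2 : ℕ) :=
    edist_le_add_one_of_adj_right (edist_x a) (by simp [RRel, ha_last])
  have edist_z2 : (SimpleGraph.fromRel (RRel m)).edist left z2 ≤ (2 : ℕ) :=
    edist_le_add_one_of_adj_right (edist_x a) (by simp [RRel, ha_first])
  rintro (i | i | _ | _ | _ | _ | _)
  exacts [(edist_x i).trans (by norm_num), (edist_y i).trans (by norm_num),
    edist_z1.trans (by norm_num), edist_z2.trans (by norm_num),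
    edist_le_add_one_of_adj_right (edist_y a) (by simp [RRel]), by simp,
    edist_le_add_one_of_adj_right (edist_y a) (by simp [RRel])]

lemma edist_le_of_forall_ne_y {s t : RVert m} (hs : s ≠ left) (hsy : ∀ i, s ≠ y i)
    (ht : t ≠ left) : (SimpleGraph.fromRel (RRel m)).edist s t ≤ (3 : ℕ) := by
  obtain ⟨j, hj⟩ : ∃ j, (SimpleGraph.fromRel (RRel m)).Adj t (y j) := by
    by_cases h : ∃ i, t = y i
    · obtain ⟨i, rfl⟩ := h
      obtain ⟨j, -, hj⟩ := exists_adj_y hm (s := right) (by simp) (by simp) i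
      exact ⟨j, hj.symm⟩
    · obtain ⟨j, hj, -⟩ := exists_adj_y hm ht (not_exists.1 h) ⟨0, by lia⟩
      exact ⟨j, hj⟩
  obtain ⟨i, hi, hij⟩ := exists_adj_y hm hs hsy j
  exact edist_le_add_one_of_adj_left hi <| edist_le_add_one_of_adj_left hij <|
    edist_le_add_one_of_adj_left (y := t) (d := 0) hj.symm (by simp)

lemma edist_le (s t : RVert m) : (SimpleGraph.fromRel (RRel m)).edist s t ≤ (3 : ℕ) := by
  by_cases hs : s = left
  · exact hs ▸ edist_left_le hm t
  by_cases ht : t = left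
  · rw [ht, SimpleGraph.edist_comm]
    exact edist_left_le hm s
  by_cases hsy : ∃ i, s = y i
  · by_cases hty : ∃ j, t = y j
    · obtain ⟨i, rfl⟩ := hsy
      obtain ⟨j, rfl⟩ := hty
      have h_right : (SimpleGraph.fromRel (RRel m)).edist right (y j) ≤ (1 : ℕ) :=
        edist_le_add_one_of_adj_left (y := y j) (d := 0) (by simp [RRel]) (by simp)
      exact (edist_le_add_one_of_adj_left (by simp [RRel]) h_right).trans (by norm_num)
    · rw [SimpleGraph.edist_comm]
      exact edist_le_of_forall_ne_y hm ht (not_exists.1 hty) hs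
  · exact edist_le_of_forall_ne_y hm hs (not_exists.1 hsy) ht

end Distance

end RVert

open RVert in
lemma graphR_hasDiameter {m : ℕ} (hm : 2 ≤ m) : (graphR m).HasDiameter 3 :=
  .of_level (ℓ := level) (edist_le hm) level_le_of_adj rfl rfl

open RVert in
lemma graphR_isChainPrefix {m : ℕ} (hm : 2 ≤ m) : (graphR m).IsChainPrefix 3 where
  critical := {
    le_card := fun _ => three_le_card_of_isLoopDominated
    exists_delete := fun s hs => by
      obtain ⟨S, hcard, hsS, hS⟩ := RVert.exists_delete hm (s := s) hs
      exact ⟨S, Nat.lt_succ_of_le hcard, hsS, fun t ht => .inl (hS t ht)⟩ }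
  le_card S hS := by
    classical
    exact Nat.succ_le_succ ((two_le_card hS).trans Finset.card_erase_le)
  exists_mem := exists_right_mem hm
  exists_notMem := by
    obtain ⟨S, hcard, hr, hS⟩ := exists_right_notMem hm
    exact ⟨S, Nat.lt_succ_of_le hcard, hr, hS⟩

/-! ### The graph `J` -/

namespace JVert

variable {t : ℕ} {S : Finset (JVert t)} {p q : Fin t × Bool}

/-- The neighbour of `p` in `tK₂`. -/
def mate (p : Fin t × Bool) : Fin t × Bool := (p.1, !p.2)

lemma mate_mate (p : Fin t × Bool) : mate (mate p) = p := by simp [mate]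

lemma mate_ne (p : Fin t × Bool) : mate p ≠ p := by simp [mate, Prod.ext_iff]

lemma graphTK2_adj : (graphTK2 t).Adj p q ↔ q = mate p := by
  rcases p with ⟨i, _ | _⟩ <;> rcases q with ⟨j, _ | _⟩ <;>
    simp [graphTK2, mate, Prod.ext_iff, eq_comm]

lemma exists_ne_mate (ht : 2 ≤ t) (p : Fin t × Bool) : ∃ q, q ≠ p ∧ q ≠ mate p := by
  have : Nontrivial (Fin t) := Fin.nontrivial_iff_two_le.2 ht
  obtain ⟨i, hi⟩ := exists_ne p.1
  exact ⟨(i, true), fun h => hi (congrArg Prod.fst h), fun h => hi (congrArg Prod.fst h)⟩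

lemma exists_iff {P : JVert t → Prop} : (∃ s, P s) ↔
    P left ∨ (∃ p, P (j1 p)) ∨ (∃ p, P (j2 p)) ∨ (∃ p, P (j3 p)) ∨ P right := by
  constructor
  · rintro ⟨_ | p | p | p | _, h⟩ <;> grind
  · grind

lemma isTotallyDominated_left : IsTotallyDominated (SimpleGraph.fromRel (JRel t)) S left ↔
    ∃ q, j1 q ∈ S := by
  grind [IsTotallyDominated, exists_iff, SimpleGraph.fromRel_adj, JRel]

lemma isTotallyDominated_j1 : IsTotallyDominated (SimpleGraph.fromRel (JRel t)) S (j1 p) ↔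
    left ∈ S ∨ j1 (mate p) ∈ S ∨ ∃ q, j2 q ∈ S ∧ q ≠ p := by
  grind [IsTotallyDominated, exists_iff, SimpleGraph.fromRel_adj, JRel, graphTK2_adj, mate_mate,
    mate_ne]

lemma isTotallyDominated_j2 : IsTotallyDominated (SimpleGraph.fromRel (JRel t)) S (j2 p) ↔
    (∃ q, j1 q ∈ S ∧ q ≠ p) ∨ (∃ q, j2 q ∈ S ∧ q ≠ p ∧ q ≠ mate p) ∨
      ∃ q, j3 q ∈ S ∧ q ≠ p := by
  grind [IsTotallyDominated, exists_iff, SimpleGraph.fromRel_adj, JRel, graphTK2_adj, mate_mate,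
    mate_ne, SimpleGraph.compl_adj]

lemma isTotallyDominated_j3 : IsTotallyDominated (SimpleGraph.fromRel (JRel t)) S (j3 p) ↔
    (∃ q, j2 q ∈ S ∧ q ≠ p) ∨ j3 (mate p) ∈ S ∨ right ∈ S := by
  grind [IsTotallyDominated, exists_iff, SimpleGraph.fromRel_adj, JRel, graphTK2_adj, mate_mate,
    mate_ne]

lemma isTotallyDominated_right : IsTotallyDominated (SimpleGraph.fromRel (JRel t)) S right ↔
    ∃ q, j3 q ∈ S := by
  grind [IsTotallyDominated, exists_iff, SimpleGraph.fromRel_adj, JRel]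

section LowerBound

lemma three_le_card_erase_left [DecidableEq (JVert t)] (ht : 2 ≤ t)
    (h : ∀ s, s ≠ left → IsTotallyDominated (SimpleGraph.fromRel (JRel t)) S s) :
    3 ≤ (S.erase left).card := by
  obtain ⟨p, hp⟩ := isTotallyDominated_right.1 (h right (by simp))
  have dom_j2 := isTotallyDominated_j2.1 (h (j2 p) (by simp))
  have dom_j3 := fun q => isTotallyDominated_j3.1 (h (j3 q) (by simp))
  by_contra hcard
  have eq_of_mem (c d : JVert t) (hc : c ∈ S ∧ c ≠ j3 p ∧ c ≠ left)
      (hd : d ∈ S ∧ d ≠ j3 p ∧ d ≠ left) : c = d := by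
    by_contra hcd
    exact hcard (Finset.two_lt_card.2 ⟨j3 p, by grind, c, by grind, d, by grind, by grind⟩)
  rcases dom_j3 p with ⟨q, hq, hqp⟩ | hmate | hr
  · have q_eq : q = mate p := by grind [dom_j3 q, mate_mate]
    grind
  · obtain ⟨q, hqp, hqm⟩ := exists_ne_mate ht p
    have mate_q_ne : mate q ≠ mate p := fun h => hqp (by rw [← mate_mate q, h, mate_mate])
    have mate_q_ne' : mate q ≠ p := fun h => hqm (by rw [← h, mate_mate])
    have eq_mate (c : JVert t) (hc : c ∈ S ∧ c ≠ j3 p ∧ c ≠ left) : c = j3 (mate p) :=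
      eq_of_mem c _ hc ⟨hmate, by simpa using mate_ne p, by simp⟩
    rcases dom_j3 q with ⟨r, hr, -⟩ | hr | hr
    · simpa using eq_mate _ ⟨hr, by simp, by simp⟩
    · exact mate_q_ne (by simpa using eq_mate _ ⟨hr, by simpa using mate_q_ne', by simp⟩)
    · simpa using eq_mate _ ⟨hr, by simp, by simp⟩
  · grind

lemma four_le_card (h : ∀ s, IsTotallyDominated (SimpleGraph.fromRel (JRel t)) S s)
    (hl : left ∉ S) : 4 ≤ S.card := by
  obtain ⟨a, ha⟩ := isTotallyDominated_left.1 (h left)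
  obtain ⟨p, hp⟩ := isTotallyDominated_right.1 (h right)
  have dom_j1 := fun q => (isTotallyDominated_j1.1 (h (j1 q))).resolve_left hl
  have dom_j2 := isTotallyDominated_j2.1 (h (j2 p))
  have dom_j3 := fun q => isTotallyDominated_j3.1 (h (j3 q))
  by_contra hcard
  have eq_of_mem (c d : JVert t) (hc : c ∈ S ∧ c ≠ j1 a ∧ c ≠ j3 p)
      (hd : d ∈ S ∧ d ≠ j1 a ∧ d ≠ j3 p) : c = d := by
    by_contra hcd
    exact hcard (Finset.three_lt_card.2
      ⟨j1 a, ha, j3 p, hp, c, hc.1, d, hd.1, by simp, hc.2.1.symm, hd.2.1.symm, hc.2.2.symm,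
        hd.2.2.symm, hcd⟩)
  obtain ⟨q, hq, hqa, hqp⟩ : ∃ q, j2 q ∈ S ∧ q ≠ a ∧ q ≠ p := by
    have j1_mate_ne : j1 (mate a) ≠ j1 a := by simpa using mate_ne a
    have j3_mate_ne : j3 (mate p) ≠ j3 p := by simpa using mate_ne p
    rcases dom_j1 a with h₁ | ⟨q, hq, hqa⟩ <;> rcases dom_j3 p with ⟨r, hr, hrp⟩ | h₃ | h₃
    · grind [eq_of_mem (j1 (mate a)) (j2 r)]
    · grind [eq_of_mem (j1 (mate a)) (j3 (mate p))]
    · grind [eq_of_mem (j1 (mate a)) right]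
    · exact ⟨q, hq, hqa, by grind [eq_of_mem (j2 q) (j2 r)]⟩
    · grind [eq_of_mem (j2 q) (j3 (mate p))]
    · grind [eq_of_mem (j2 q) right]
  have mate_q_eq_a : mate q = a := by grind [dom_j1 q]
  have mate_q_eq_p : mate q = p := by grind [dom_j3 q]
  grind [mate_mate]

end LowerBound

section UpperBound

lemma exists_left_mem (ht : 0 < t) : ∃ S : Finset (JVert t), S.card ≤ 4 ∧ left ∈ S ∧
    ∀ s, IsTotallyDominated (SimpleGraph.fromRel (JRel t)) S s := by
  classical
  let o : Fin t × Bool := (⟨0, ht⟩, false)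
  refine ⟨{left, right, j1 o, j3 (mate o)}, Finset.card_le_four, by simp, ?_⟩
  rintro (_ | p | p | p | _) <;>
    grind [isTotallyDominated_left, isTotallyDominated_j1, isTotallyDominated_j2,
      isTotallyDominated_j3, isTotallyDominated_right, mate_ne]

lemma exists_delete_j2 (a : Fin t × Bool) : ∃ S : Finset (JVert t), S.card ≤ 3 ∧ j2 a ∉ S ∧
    ∀ s, s ≠ j2 a → IsLoopDominated (SimpleGraph.fromRel (JRel t)) {left} S s := by
  classical
  refine ⟨{left, j3 a, j2 (mate a)}, Finset.card_le_three, by grind [mate_ne], ?_⟩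
  rintro (_ | p | p | p | _) hs <;>
    grind [IsLoopDominated, isTotallyDominated_j1, isTotallyDominated_j2,
      isTotallyDominated_j3, isTotallyDominated_right, mate_mate]

variable (ht : 2 ≤ t)
include ht

lemma exists_left_notMem : ∃ S : Finset (JVert t), S.card ≤ 3 ∧ left ∉ S ∧
    ∀ s, s ≠ left → IsTotallyDominated (SimpleGraph.fromRel (JRel t)) S s := by
  classical
  let o : Fin t × Bool := (⟨0, by lia⟩, false)
  obtain ⟨q, hqo, hqm⟩ := exists_ne_mate ht o
  refine ⟨{j2 o, j2 (mate o), j3 q}, Finset.card_le_three, by simp, ?_⟩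
  rintro (_ | p | p | p | _) hs <;>
    grind [isTotallyDominated_j1, isTotallyDominated_j2, isTotallyDominated_j3,
      isTotallyDominated_right, mate_mate, mate_ne]

lemma exists_delete_j1 (a : Fin t × Bool) : ∃ S : Finset (JVert t), S.card ≤ 3 ∧ j1 a ∉ S ∧
    ∀ s, s ≠ j1 a → IsLoopDominated (SimpleGraph.fromRel (JRel t)) {left} S s := by
  classical
  obtain ⟨c, hca, hcm⟩ := exists_ne_mate ht a
  refine ⟨{j1 c, j2 a, j3 (mate a)}, Finset.card_le_three, by grind, ?_⟩
  rintro (_ | p | p | p | _) hs <;>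
    grind [IsLoopDominated, isTotallyDominated_left, isTotallyDominated_j1,
      isTotallyDominated_j2, isTotallyDominated_j3, isTotallyDominated_right, mate_ne]

lemma exists_delete_j3 (a : Fin t × Bool) : ∃ S : Finset (JVert t), S.card ≤ 3 ∧ j3 a ∉ S ∧
    ∀ s, s ≠ j3 a → IsLoopDominated (SimpleGraph.fromRel (JRel t)) {left} S s := by
  classical
  obtain ⟨c, hca, hcm⟩ := exists_ne_mate ht a
  refine ⟨{left, j2 a, j3 c}, Finset.card_le_three, by grind, ?_⟩
  rintro (_ | p | p | p | _) hs <;>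
    grind [IsLoopDominated, isTotallyDominated_j1, isTotallyDominated_j2,
      isTotallyDominated_j3, isTotallyDominated_right, mate_mate]

lemma exists_delete_right : ∃ S : Finset (JVert t), S.card ≤ 3 ∧ right ∉ S ∧
    ∀ s, s ≠ right → IsLoopDominated (SimpleGraph.fromRel (JRel t)) {left} S s := by
  classical
  let o : Fin t × Bool := (⟨0, by lia⟩, false)
  obtain ⟨q, hqo, hqm⟩ := exists_ne_mate ht o
  refine ⟨{left, j2 o, j2 q}, Finset.card_le_three, by simp, ?_⟩
  rintro (_ | p | p | p | _) hs <;>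
    grind [IsLoopDominated, isTotallyDominated_j1, isTotallyDominated_j2,
      isTotallyDominated_j3, mate_mate]

lemma exists_delete {s : JVert t} (hl : s ≠ left) :
    ∃ S : Finset (JVert t), S.card ≤ 3 ∧ s ∉ S ∧
      ∀ s', s' ≠ s → IsLoopDominated (SimpleGraph.fromRel (JRel t)) {left} S s' := by
  rcases s with _ | a | a | a | _
  exacts [absurd rfl hl, exists_delete_j1 ht a, exists_delete_j2 a, exists_delete_j3 ht a,
    exists_delete_right ht]

end UpperBound

section Distance

/-- The distance from Left. -/
def level : JVert t → ℕ
  | left => 0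
  | j1 _ => 1
  | j2 _ => 2
  | j3 _ => 3
  | right => 4

lemma level_le_of_adj (s s' : JVert t) (h : (SimpleGraph.fromRel (JRel t)).Adj s s') :
    level s' ≤ level s + 1 := by
  rcases s with _ | _ | _ | _ | _ <;> rcases s' with _ | _ | _ | _ | _ <;>
    simp [JRel, level] at h ⊢

lemma edist_left_le (ht : 0 < t) :
    ∀ s, (SimpleGraph.fromRel (JRel t)).edist left s ≤ level s := by
  have edist_j1 (p : Fin t × Bool) :
      (SimpleGraph.fromRel (JRel t)).edist left (j1 p) ≤ (1 : ℕ) :=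
    edist_le_add_one_of_adj_right (y := left) (d := 0) (by simp) (by simp [JRel])
  have edist_j2 (p : Fin t × Bool) :
      (SimpleGraph.fromRel (JRel t)).edist left (j2 p) ≤ (2 : ℕ) :=
    edist_le_add_one_of_adj_right (edist_j1 (mate p)) (by simpa [JRel] using mate_ne p)
  have edist_j3 (p : Fin t × Bool) :
      (SimpleGraph.fromRel (JRel t)).edist left (j3 p) ≤ (3 : ℕ) :=
    edist_le_add_one_of_adj_right (edist_j2 (mate p)) (by simpa [JRel] using mate_ne p)
  rintro (_ | p | p | p | _)
  exacts [by simp, edist_j1 p, edist_j2 p, edist_j3 p,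
    edist_le_add_one_of_adj_right (edist_j3 (⟨0, ht⟩, false)) (by simp [JRel])]

lemma edist_right_le (ht : 0 < t) :
    ∀ s, (SimpleGraph.fromRel (JRel t)).edist s right ≤ (4 - level s : ℕ) := by
  have edist_j3 (p : Fin t × Bool) :
      (SimpleGraph.fromRel (JRel t)).edist (j3 p) right ≤ (1 : ℕ) :=
    edist_le_add_one_of_adj_left (y := right) (d := 0) (by simp [JRel]) (by simp)
  have edist_j2 (p : Fin t × Bool) :
      (SimpleGraph.fromRel (JRel t)).edist (j2 p) right ≤ (2 : ℕ) :=
    edist_le_add_one_of_adj_left (by simpa [JRel] using (mate_ne p).symm) (edist_j3 (mate p))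
  have edist_j1 (p : Fin t × Bool) :
      (SimpleGraph.fromRel (JRel t)).edist (j1 p) right ≤ (3 : ℕ) :=
    edist_le_add_one_of_adj_left (by simpa [JRel] using (mate_ne p).symm) (edist_j2 (mate p))
  rintro (_ | p | p | p | _)
  exacts [edist_le_add_one_of_adj_left (by simp [JRel]) (edist_j1 (⟨0, ht⟩, false)),
    edist_j1 p, edist_j2 p, edist_j3 p, by simp]

lemma edist_left_add_edist_right_le (ht : 0 < t) (s : JVert t) :
    (SimpleGraph.fromRel (JRel t)).edist left s + (SimpleGraph.fromRel (JRel t)).edist s right ≤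
      (4 : ℕ) := by
  refine (add_le_add (edist_left_le ht s) (edist_right_le ht s)).trans ?_
  have level_le : level s ≤ 4 := by cases s <;> simp [level]
  exact_mod_cast (Nat.add_sub_of_le level_le).le

end Distance

end JVert

open JVert in
lemma graphJ_hasDiameter {t : ℕ} (ht : 0 < t) : (graphJ t).HasDiameter 4 :=
  .of_level (ℓ := level) (edist_le_of_edist_add_edist_le (edist_left_add_edist_right_le ht))
    level_le_of_adj rfl rfl

open JVert in
lemma graphJ_isChainExtension {t : ℕ} (ht : 2 ≤ t) : (graphJ t).IsChainExtension 3 ∅ where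
  left_notMem := Set.notMem_empty _
  le_card_erase := @fun (_ : DecidableEq (JVert t)) _ hS =>
    three_le_card_erase_left ht fun s hs => isLoopDominated_empty.1 (hS s hs)
  lt_card _ hl hS := four_le_card (fun s => isLoopDominated_empty.1 (hS s)) hl
  exists_mem := by
    simp only [isLoopDominated_empty]
    exact JVert.exists_left_mem (two_pos.trans_le ht)
  exists_notMem := by
    simp only [isLoopDominated_empty]
    exact JVert.exists_left_notMem ht
  exists_delete _ _ hl := by
    rw [insert_empty_eq]
    exact JVert.exists_delete ht hl

theorem mainTheorem6_general {W : Type*} (H : SimpleGraph W)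
    (hH : totalDominationNumber H = 2) (hHc : totalDominationNumber Hᶜ = 2)
    (m t : ℕ) (hm : 2 ≤ m) (ht : 2 ≤ t) (n : ℕ) :
    IsTotalDominationVertexCritical (graphRQJ m H t n).graph (3 * n + 6) ∧
      (graphRQJ m H t n).IsDiametrical ∧
      (graphRQJ m H t n).graph.diam = 5 * n + 7 ∧
      ∀ v, ∃ S, IsTotalDominatingSet (deleteVertex (graphRQJ m H t n).graph v) S ∧
        S.card = 3 * n + 5 := by
  have pair_H := exists_pair_of_totalDominationNumber_eq_two hH
  have pair_Hc := exists_pair_of_totalDominationNumber_eq_two hHc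
  have : Nontrivial W := by
    obtain ⟨a, b, hab⟩ := pair_H
    exact (hab a).elim (fun h => ⟨a, a, h.ne⟩) fun h => ⟨a, b, h.ne⟩
  have hcrit : IsLoopCritical (graphRQJ m H t n).graph ∅ (3 * n + 5 + 1) := by
    have hRQ := (graphR_isChainPrefix hm).glue_pow (graphQ_isChainLink pair_H pair_Hc)
      (graphQ_hasDiameter H) (by norm_num) n
    have hRQJ := hRQ.isLoopCritical_glue (graphJ_isChainExtension ht)
    rwa [Set.image_empty, show 3 + n * 3 + 3 = 3 * n + 5 + 1 by ring] at hRQJ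
  have hdiam : (graphRQJ m H t n).HasDiameter (5 * n + 7) := by
    have hRQJ := ((graphR_hasDiameter hm).glue ((graphQ_hasDiameter H).pow n)).glue
      (graphJ_hasDiameter (two_pos.trans_le ht))
    rwa [show 3 + n * 5 + 4 = 5 * n + 7 by ring] at hRQJ
  have := hdiam.nontrivial (by lia)
  exact ⟨hcrit.isTotalDominationVertexCritical, hdiam.isDiametrical, hdiam.diam,
    hcrit.exists_deleteVertex⟩

theorem mainTheorem6 {W : Type*} [Finite W] (H : SimpleGraph W) (hW : 4 ≤ Nat.card W)
    (hH : totalDominationNumber H = 2) (hHc : totalDominationNumber Hᶜ = 2)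
    (m t : ℕ) (hm : 2 ≤ m) (ht : 2 ≤ t) (n : ℕ) :
    IsTotalDominationVertexCritical (graphRQJ m H t n).graph (3 * n + 6) ∧
      (graphRQJ m H t n).IsDiametrical ∧
      (graphRQJ m H t n).graph.diam = 5 * n + 7 ∧
      ∀ v, ∃ S, IsTotalDominatingSet (deleteVertex (graphRQJ m H t n).graph v) S ∧
        S.card = 3 * n + 5 :=
  mainTheorem6_general H hH hHc m t hm ht n
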